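/- Let $B=\{B_t,t\ge 0\}$ be a standard Brownian motion on a complete probability space $(\Omega,\mathcal A,P)$, let $\mathcal F$ be the $P$-completion of the $\sigma$-field generated by $B$, and let $(\mathcal F_t)$ be the ($P$-completed) natural filtration of $B$. Let $u=\{u_t,t\in[0,1]\}$ be a real process that is progressively measurable with respect to $(\mathcal F_t)$, satisfies $\int_0^1 E(u_t^2)\,dt<\infty$, and is continuous in $L^2(\Omega)$ at $t=1$, that is, $E[(u_t-u_1)^2]\to 0$ as $t\uparrow 1$. Let $\phi_n$, $n\ge 1$, be bounded nonnegative measurable functions on $[0,1]$ and let $L>0$ be such that (h1) there is a sequence $\alpha_n\in[0,1]$ with $\alpha_n\uparrow 1$ and $$\lim_{n\to\infty}\int_{\alpha_n}^1\phi_n^2(t)\,dt=\lim_{n\to\infty}\int_0^1\phi_n^2(t)\,dt=L;$$ (h2) for every $\delta\in[0,1)$, $\sup_{0\le t\le\delta}\phi_n(t)\to 0$ as $n\to\infty$. Then the Itô integrals $F_n:=\int_0^1\phi_n(t)u_t\,dB_t$ are well defined and converge stably, as $n\to\infty$, to $\sqrt L\,u_1Z$, where $Z$ is an $N(0,1)$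 random variable, defined on an extension $(\Omega',\mathcal A',P')$ of $(\Omega,\mathcal A,P)$, that is independent of the process $B$ (such extensions exist, and the convergence holds for each of them). Here stable convergence means that for every $\lambda\in\mathbb R$ and every bounded $\mathcal F$-measurable random variable $Y$, $$\lim_{n\to\infty}E\big[Y e^{i\lambda F_n}\big]=E'\big[Y e^{i\lambda\sqrt L\,u_1Z}\big],$$ where on the right $Y$ and $u_1$ are regarded as random variables on $\Omega'$. -/

import Mathlib

open MeasureTheory ProbabilityTheory Filter Topology
open scoped NNReal ENNReal unitInterval

universe u v

section BrownianFiltration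

variable {Ω : Type u} [mΩ : MeasurableSpace Ω]

/-- The `P`-completion of the σ-field generated by the whole process `B`: the sets that differ
from an element of `σ(B t, t ≥ 0)` by a `P`-null set. -/
@[reducible] def brownianSigma (P : Measure Ω) (B : ℝ≥0 → Ω → ℝ) : MeasurableSpace Ω :=
  eventuallyMeasurableSpace (⨆ s : ℝ≥0, MeasurableSpace.comap (B s) inferInstance) (ae P)

/-- The `P`-completion of the σ-field `σ(B s, 0 ≤ s ≤ t)`. -/
@[reducible] def brownianSigmaUpTo (P : Measure Ω) (B : ℝ≥0 → Ω → ℝ) (t : ℝ≥0) : MeasurableSpace Ω :=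
  eventuallyMeasurableSpace (⨆ s : Set.Iic t, MeasurableSpace.comap (B s) inferInstance) (ae P)

/-- On a complete probability space, the natural filtration of the process `B` over the time
interval `[0, 1]`, completed with the `P`-null sets. -/
def brownianFiltration (P : Measure Ω) [P.IsComplete] (B : ℝ≥0 → Ω → ℝ)
    (hB : ∀ t, Measurable (B t)) : Filtration I mΩ where
  seq t := brownianSigmaUpTo P B (unitInterval.toNNReal t)
  mono' := by
    rintro s t hst A ⟨A', hA', h⟩
    refine ⟨A', ?_, h⟩
    have hle : (⨆ r : Set.Iic (unitInterval.toNNReal s),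
        MeasurableSpace.comap (B r) inferInstance) ≤
        ⨆ r : Set.Iic (unitInterval.toNNReal t), MeasurableSpace.comap (B r) inferInstance := by
      refine iSup_le fun r => ?_
      exact le_iSup (fun r : Set.Iic (unitInterval.toNNReal t) =>
        MeasurableSpace.comap (B r) inferInstance) ⟨r.1, le_trans (show r.1 ≤ unitInterval.toNNReal s from r.2) hst⟩
    exact hle _ hA'
  le' := by
    rintro t A ⟨A', hA', h⟩
    have hle : (⨆ r : Set.Iic (unitInterval.toNNReal t),
        MeasurableSpace.comap (B r) inferInstance) ≤ mΩ :=
      iSup_le fun r => (hB r).comap_le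
    exact NullMeasurableSet.measurable_of_complete ⟨A', hle _ hA', h⟩

end BrownianFiltration

section ItoIntegral

variable {Ω : Type u} [mΩ : MeasurableSpace Ω]

/-- A simple process on `[0, 1]`: a finite sum `∑ i, ξ i * 1_{(a i, b i]}` with `a i ≤ b i` and
`ξ i` bounded and measurable at time `a i`. -/
structure SimpleItoProcess (𝓕 : Filtration I mΩ) where
  /-- the number of summands -/
  size : ℕ
  /-- the left end points -/
  a : Fin size → I
  /-- the right end points -/
  b : Fin size → I
  le : ∀ i, a i ≤ b i
  /-- the random coefficients -/
  ξ : Fin size → Ω → ℝ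
  measurable : ∀ i, Measurable[𝓕 (a i)] (ξ i)
  bounded : ∀ i, ∃ C : ℝ, ∀ ω, |ξ i ω| ≤ C

/-- The value at time `t` of a simple process. -/
noncomputable def SimpleItoProcess.eval {𝓕 : Filtration I mΩ} (V : SimpleItoProcess 𝓕)
    (t : I) (ω : Ω) : ℝ :=
  ∑ i, (Set.Ioc (V.a i) (V.b i)).indicator (fun _ => V.ξ i ω) t

/-- The elementary stochastic integral `∑ i, ξ i * (B (b i) - B (a i))` of a simple process. -/
noncomputable def SimpleItoProcess.integral {𝓕 : Filtration I mΩ} (V : SimpleItoProcess 𝓕)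
    (B : ℝ≥0 → Ω → ℝ) (ω : Ω) : ℝ :=
  ∑ i, V.ξ i ω * (B (unitInterval.toNNReal (V.b i)) ω - B (unitInterval.toNNReal (V.a i)) ω)

/-- `Y` is (a version of) the Itô integral `∫₀¹ X_t dB_t`: it is the limit in `L²(P)` of the
elementary integrals of a sequence of simple processes that converges to `X` in
`L²([0, 1] × Ω, dt ⊗ P)`. -/
def IsItoIntegral (P : Measure Ω) (𝓕 : Filtration I mΩ) (B : ℝ≥0 → Ω → ℝ)
    (X : I → Ω → ℝ) (Y : Ω → ℝ) : Prop :=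
  MemLp Y 2 P ∧ ∃ V : ℕ → SimpleItoProcess 𝓕,
    Tendsto (fun k => ∫⁻ t : I, ∫⁻ ω, ‖(V k).eval t ω - X t ω‖ₑ ^ 2 ∂P) atTop (𝓝 0) ∧
    Tendsto (fun k => eLpNorm (fun ω => (V k).integral B ω - Y ω) 2 P) atTop (𝓝 0)

open Classical in
/-- The Itô integral `∫₀¹ X_t dB_t` (a version of it, and `0` if there is none). -/
noncomputable def itoIntegral (P : Measure Ω) (𝓕 : Filtration I mΩ) (B : ℝ≥0 → Ω → ℝ)
    (X : I → Ω → ℝ) : Ω → ℝ :=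
  if h : ∃ Y, IsItoIntegral P 𝓕 B X Y then h.choose else 0

end ItoIntegral

section StableConvergence

variable {Ω : Type u} [MeasurableSpace Ω] {Ω' : Type v} [MeasurableSpace Ω']

/-- `(Ω', P')` with the projection `π : Ω' → Ω` is an extension of the probability space `(Ω, P)`,
and `Z` is a standard normal random variable on it that is independent of the process `B`. -/
structure IsIndepNormalOnExtension (P : Measure Ω) (B : ℝ≥0 → Ω → ℝ) (P' : Measure Ω')
    (π : Ω' → Ω) (Z : Ω' → ℝ) : Prop where
  extension : MeasurePreserving π P' P
  law : HasLaw Z (gaussianReal 0 1) P'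
  indep : IndepFun Z (fun ω' (t : ℝ≥0) => B t (π ω')) P'

/-- Stable convergence, with respect to the σ-field `𝓖`, of random variables `F n` on `(Ω, P)` to a
random variable `G` on the extension `(Ω', P')` with projection `π : Ω' → Ω`:
`E[Y exp(i r F n)] → E'[Y exp(i r G)]` for all real `r` and all bounded `𝓖`-measurable `Y`. -/
def ConvergesStably (P : Measure Ω) (𝓖 : MeasurableSpace Ω) (F : ℕ → Ω → ℝ)
    (P' : Measure Ω') (π : Ω' → Ω) (G : Ω' → ℝ) : Prop :=
  (∀ n, AEMeasurable (F n) P) ∧ AEMeasurable G P' ∧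
  ∀ (r : ℝ) (Y : Ω → ℝ), Measurable[𝓖] Y → (∃ C : ℝ, ∀ ω, |Y ω| ≤ C) →
    Tendsto (fun n => ∫ ω, (Y ω : ℂ) * Complex.exp (Complex.I * (r * F n ω : ℝ)) ∂P) atTop
      (𝓝 (∫ ω', (Y (π ω') : ℂ) * Complex.exp (Complex.I * (r * G ω' : ℝ)) ∂P'))

end StableConvergence

/-!
The Itô integral is an isometry from `L²(dt ⊗ P)` to `L²(P)`, and this reduces the theorem to a
statement about Wiener integrals. Given `ε > 0`, the continuity of `u` at `1` yields `δ < 1` and a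
variable `v` with finitely many values, known at time `δ`, such that `u t` is `ε`-close to `v` in
`L²(P)` for all `t ∈ [δ, 1]`, and in particular `u 1` is (`exists_finite_range_approx`). As `φ n`
tends to `0` uniformly on `[0, δ]`, the Itô integral `F n` of `φ n * u` is asymptotically
`ε √L`-close in `L²(P)` to the Itô integral of `1_{(δ, 1]} φ n v` (`eventually_processDist_le`), and
the latter is `v * G n`, where `G n` is the Wiener integral of `φ n` over `(δ, 1]`
(`exists_wienerIntegral`).

The heart of the matter is that the `G n` are asymptotically `N(0, L)` and asymptotically
independent of the whole of `B` (`exists_wienerIntegral_mixing`). For every `δ' ∈ [δ, 1)`, replacing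
the lower limit `δ` by `δ'` changes `G n` by a quantity that tends to `0` in `L²(P)`. The Wiener
integral over `(δ', 1]` is a limit of linear combinations of increments of `B` inside `[δ', 1]`;
hence it is centered normal with variance `∫_{(δ', 1]} φ n ^ 2`, which tends to `L`, and it is
independent of the σ-field generated by `B` up to time `δ'` and by the increments of `B` after time
`1`, since jointly Gaussian uncorrelated families are independent (`indepFun_outside`). By the
continuity of `B` at time `1`, these σ-fields generate that of `B` up to null sets as `δ' ↑ 1`
(`iSup_comap_le_eventually_outside`), and a π-λ argument extends the asymptotic independence to it.

Conditioning on the values of `v`, the functionals `E[Y exp(i r v G n)]` converge, and their limit is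
`E'[Y exp(i r v √L Z)]`, since the constant sequence `√L Z` on the extension satisfies the same mixing
relation (`tendsto_integral_mul_exp_of_mixing` covers both). Replacing `v` by `u 1` costs `O(ε)`.

The existence of the Itô integrals requires that simple processes are dense among the progressive
processes in `L²(dt ⊗ P)` (`exists_tendsto_simple`). A bounded process is approximated by its means
over the preceding mesh intervals, which are adapted and converge for almost every time by the
Lebesgue differentiation theorem; truncation handles the general case. For a deterministic process
these approximations are deterministic, which is what makes the Wiener integrals Gaussian.
-/

/-! ### Means over preceding mesh intervals -/

section Approximation

lemma measurable_setIntegral_right {Ω : Type*} {m : MeasurableSpace Ω} {f : ℝ → Ω → ℝ}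
    (hf : Measurable (fun p : ℝ × Ω => f p.1 p.2)) (s : Set ℝ) :
    Measurable (fun ω => ∫ x in s, f x ω) :=
  (hf.stronglyMeasurable.integral_prod_left' (μ := volume.restrict s)).measurable

variable {Ω : Type u}

/-- The process `X`, extended by `0` to a process indexed by `ℝ`. -/
noncomputable def extendZero (X : I → Ω → ℝ) (s : ℝ) (ω : Ω) : ℝ :=
  (Set.Icc (0 : ℝ) 1).indicator (fun s => X (Set.projIcc 0 1 zero_le_one s) ω) s

/-- The point `i / n` of the unit interval, for `i ≤ n`; it is `1` for `i > n > 0`. -/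
noncomputable def meshPoint (n i : ℕ) : I := Set.projIcc 0 1 zero_le_one (i / n : ℝ)

lemma coe_meshPoint {n i : ℕ} (h : i ≤ n) : ((meshPoint n i : I) : ℝ) = i / n := by
  unfold meshPoint
  rw [Set.coe_projIcc, min_eq_right, max_eq_right]
  · positivity
  · exact div_le_one_of_le₀ (by exact_mod_cast h) (by positivity)

lemma meshPoint_mono (n : ℕ) : Monotone (meshPoint n) := by
  intro i j h
  exact Set.monotone_projIcc _ (by gcongr)

/-- The mean of `X` over the interval `[(i - 1) / n, i / n]`, with `X` extended by `0`. The interval is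
written as a closed ball, as in the Lebesgue differentiation theorem. -/
noncomputable def meanCoeff (X : I → Ω → ℝ) (n i : ℕ) (ω : Ω) : ℝ :=
  ⨍ s in Metric.closedBall ((i - 1 / 2) / n : ℝ) (1 / 2 / n), extendZero X s ω

lemma abs_extendZero_le {X : I → Ω → ℝ} {C : ℝ} (hC : ∀ t ω, |X t ω| ≤ C) (s : ℝ) (ω : Ω) :
    |extendZero X s ω| ≤ C := by
  unfold extendZero
  by_cases h : s ∈ Set.Icc (0 : ℝ) 1
  · rw [Set.indicator_of_mem h]; exact hC _ _
  · rw [Set.indicator_of_notMem h]; simpa using (abs_nonneg _).trans (hC 0 ω)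

lemma abs_meanCoeff_le {X : I → Ω → ℝ} {C : ℝ} (hC : ∀ t ω, |X t ω| ≤ C) (n i : ℕ) (ω : Ω) :
    |meanCoeff X n i ω| ≤ C := by
  have hC0 : 0 ≤ C := (abs_nonneg _).trans (hC 0 ω)
  unfold meanCoeff
  rw [setAverage_eq, smul_eq_mul, abs_mul, abs_inv, abs_of_nonneg measureReal_nonneg]
  have h := norm_setIntegral_le_of_norm_le_const (μ := volume)
    (s := Metric.closedBall ((i - 1 / 2) / n : ℝ) (1 / 2 / n)) (f := fun s => extendZero X s ω)
    (C := C) (measure_closedBall_lt_top)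
    (fun s _ => by simpa using abs_extendZero_le hC s ω)
  rw [Real.norm_eq_abs] at h
  rw [inv_mul_eq_div]
  exact div_le_of_le_mul₀ measureReal_nonneg hC0 h

variable [mΩ : MeasurableSpace Ω]

lemma MeasureTheory.IsProgressive.measurable_uncurry {𝓕 : Filtration I mΩ} {X : I → Ω → ℝ}
    (hX : IsProgressive 𝓕 X) : Measurable (fun p : I × Ω => X p.1 p.2) := by
  have h := (hX 1).mono (sup_le_sup le_rfl (MeasurableSpace.comap_mono (𝓕.le 1))) le_rfl
  exact h.comp (g := fun p : Set.Iic (1 : I) × Ω => X p.1 p.2)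
    (f := fun p : I × Ω => ((⟨p.1, unitInterval.le_one'⟩ : Set.Iic (1 : I)), p.2)) (by fun_prop)

lemma measurable_extendZero {𝓕 : Filtration I mΩ} {X : I → Ω → ℝ}
    (hX : IsProgressive 𝓕 X) : Measurable (fun p : ℝ × Ω => extendZero X p.1 p.2) := by
  have : (fun p : ℝ × Ω => extendZero X p.1 p.2) =
      (Prod.fst ⁻¹' (Set.Icc (0 : ℝ) 1)).indicator
        (fun p : ℝ × Ω => X (Set.projIcc 0 1 zero_le_one p.1) p.2) := by
    ext p; simp [extendZero, Set.indicator]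
  rw [this]
  refine Measurable.indicator ?_ (measurable_fst measurableSet_Icc)
  exact hX.measurable_uncurry.comp
    (((continuous_projIcc (h := zero_le_one)).measurable.comp measurable_fst).prodMk measurable_snd)

lemma measurable_meanCoeff {𝓕 : Filtration I mΩ} {X : I → Ω → ℝ} (hX : IsProgressive 𝓕 X)
    (n i : ℕ) : Measurable[𝓕 (meshPoint n i)] (meanCoeff X n i) := by
  set a := meshPoint n i with ha
  -- only the values of `X` up to time `i / n` enter the mean
  have key : meanCoeff X n i = fun ω => (volume.real
      (Metric.closedBall ((i - 1 / 2) / n : ℝ) (1 / 2 / n)))⁻¹ •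
      ∫ s in Metric.closedBall ((i - 1 / 2) / n : ℝ) (1 / 2 / n),
        (Set.Icc (0 : ℝ) 1).indicator
          (fun s => X (min (Set.projIcc 0 1 zero_le_one s) a) ω) s := by
    ext ω
    unfold meanCoeff
    rw [setAverage_eq]
    congr 1
    refine setIntegral_congr_fun Metric.isClosed_closedBall.measurableSet fun s hs => ?_
    unfold extendZero
    by_cases h : s ∈ Set.Icc (0 : ℝ) 1
    · rw [Set.indicator_of_mem h, Set.indicator_of_mem h, min_eq_left]
      rw [ha, meshPoint]
      refine Set.monotone_projIcc _ ?_
      rw [Real.closedBall_eq_Icc] at hs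
      calc s ≤ _ := hs.2
        _ = i / n := by ring
    · rw [Set.indicator_of_notMem h, Set.indicator_of_notMem h]
  rw [key]
  let _ : MeasurableSpace Ω := 𝓕 a
  refine (measurable_setIntegral_right (f := fun s ω => (Set.Icc (0 : ℝ) 1).indicator
          (fun s => X (min (Set.projIcc 0 1 zero_le_one s) a) ω) s) ?_ _).const_mul _
  have : (fun p : ℝ × Ω => (Set.Icc (0 : ℝ) 1).indicator
          (fun s => X (min (Set.projIcc 0 1 zero_le_one s) a) p.2) p.1) =
      (Prod.fst ⁻¹' (Set.Icc (0 : ℝ) 1)).indicator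
        (fun p : ℝ × Ω => X (min (Set.projIcc 0 1 zero_le_one p.1) a) p.2) := by
    ext p; simp [Set.indicator]
  rw [this]
  refine Measurable.indicator ?_ (measurable_fst measurableSet_Icc)
  refine (hX a).comp (f := fun p : ℝ × Ω =>
    ((⟨min (Set.projIcc 0 1 zero_le_one p.1) a, Set.mem_Iic.2 (min_le_right _ _)⟩ : Set.Iic a), p.2)) ?_
  refine Measurable.prodMk (Measurable.subtype_mk ?_) measurable_snd
  exact (((continuous_projIcc (h := zero_le_one)).measurable.comp measurable_fst).min
    measurable_const)

/-- The simple process whose value on `(i / n, (i + 1) / n]` is the mean of the bounded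
progressive process `X` over the preceding mesh interval. -/
noncomputable def meanProcess {𝓕 : Filtration I mΩ} {X : I → Ω → ℝ} (hX : IsProgressive 𝓕 X)
    {C : ℝ} (hC : ∀ t ω, |X t ω| ≤ C) (n : ℕ) : SimpleItoProcess 𝓕 where
  size := n
  a i := meshPoint n i
  b i := meshPoint n (i + 1)
  le _ := meshPoint_mono n (Nat.le_succ _)
  ξ i := meanCoeff X n i
  measurable i := measurable_meanCoeff hX n i
  bounded i := ⟨C, abs_meanCoeff_le hC n i⟩

lemma meanProcess_eval_of_mem {𝓕 : Filtration I mΩ} {X : I → Ω → ℝ} (hX : IsProgressive 𝓕 X)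
    {C : ℝ} (hC : ∀ t ω, |X t ω| ≤ C) {n : ℕ} {t : I} (i : Fin n)
    (hi : t ∈ Set.Ioc (meshPoint n i) (meshPoint n (i + 1))) (ω : Ω) :
    (meanProcess hX hC n).eval t ω = meanCoeff X n i ω := by
  unfold SimpleItoProcess.eval
  refine (Finset.sum_eq_single i ?_ ?_).trans ?_
  · intro j _ hj
    refine Set.indicator_of_notMem (fun h => ?_) _
    rcases lt_or_gt_of_ne hj with h' | h'
    · exact absurd (h.2.trans (meshPoint_mono n (Nat.succ_le_of_lt h'))) (not_le.2 hi.1)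
    · exact absurd (hi.2.trans (meshPoint_mono n (Nat.succ_le_of_lt h'))) (not_le.2 h.1)
  · intro h; exact absurd (Finset.mem_univ _) h
  · exact Set.indicator_of_mem hi _

lemma exists_mem_mesh {n : ℕ} (hn : 0 < n) {t : I} (ht : 0 < t) :
    ∃ i : Fin n, t ∈ Set.Ioc (meshPoint n i) (meshPoint n (i + 1)) ∧
      (i / n : ℝ) < t ∧ (t : ℝ) ≤ (i + 1) / n := by
  have hn' : (0 : ℝ) < n := by exact_mod_cast hn
  have ht' : (0 : ℝ) < t := by exact_mod_cast ht
  have hpos : 0 < ⌈(t : ℝ) * n⌉₊ := Nat.ceil_pos.2 (by positivity)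
  have hle : ⌈(t : ℝ) * n⌉₊ ≤ n := by
    refine Nat.ceil_le.2 ?_
    exact mul_le_of_le_one_left hn'.le t.2.2
  obtain ⟨j, hj⟩ : ∃ j, ⌈(t : ℝ) * n⌉₊ = j + 1 := ⟨_, (Nat.succ_pred_eq_of_pos hpos).symm⟩
  have h1 : (t : ℝ) * n ≤ j + 1 := by
    have := Nat.le_ceil ((t : ℝ) * n); rw [hj] at this; exact_mod_cast this
  have h2 : (j : ℝ) < t * n := by
    have := Nat.lt_ceil.1 (show j < ⌈(t : ℝ) * n⌉₊ by omega); exact this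
  have h3 : (j / n : ℝ) < t := by rwa [div_lt_iff₀ hn']
  have h4 : (t : ℝ) ≤ (j + 1) / n := by rwa [le_div_iff₀ hn']
  refine ⟨⟨j, by omega⟩, ⟨?_, ?_⟩, h3, h4⟩
  · rw [← Subtype.coe_lt_coe, coe_meshPoint (by simp; omega)]; exact h3
  · rw [← Subtype.coe_le_coe, coe_meshPoint (by simp; omega)]; push_cast; exact h4

lemma abs_meanProcess_eval_le {𝓕 : Filtration I mΩ} {X : I → Ω → ℝ} (hX : IsProgressive 𝓕 X)
    {C : ℝ} (hC : ∀ t ω, |X t ω| ≤ C) {n : ℕ} (hn : 0 < n) {t : I} (ht : 0 < t) (ω : Ω) :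
    |(meanProcess hX hC n).eval t ω| ≤ C := by
  obtain ⟨i, hi, -⟩ := exists_mem_mesh hn ht
  rw [meanProcess_eval_of_mem hX hC i hi]
  exact abs_meanCoeff_le hC _ _ _

/-- The Lebesgue differentiation theorem for the means of a bounded process over the preceding
mesh intervals. -/
lemma ae_tendsto_meanProcess {𝓕 : Filtration I mΩ} {X : I → Ω → ℝ} (hX : IsProgressive 𝓕 X)
    {C : ℝ} (hC : ∀ t ω, |X t ω| ≤ C) (ω : Ω) :
    ∀ᵐ t : I, Tendsto (fun n : ℕ => (meanProcess hX hC (n + 1)).eval t ω) atTop (𝓝 (X t ω)) := by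
  have hm : Measurable (fun s => extendZero X s ω) :=
    (measurable_extendZero hX).comp (measurable_id.prodMk measurable_const)
  have hloc : LocallyIntegrable (fun s => extendZero X s ω) volume := by
    refine (locallyIntegrable_const C).mono hm.aestronglyMeasurable (ae_of_all _ fun s => ?_)
    exact (abs_extendZero_le hC s ω).trans (le_abs_self _)
  -- `t` lies in the mesh interval that follows the interval of averaging, hence in the ball with
  -- the same center as the latter and three times its radius
  have h := IsUnifLocDoublingMeasure.ae_tendsto_average (μ := volume) hloc 3
  have h' : ∀ᵐ t : I, ∀ {ι : Type} {l : Filter ι} (w : ι → ℝ) (δ : ι → ℝ)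
      (_ : Tendsto δ l (𝓝[>] 0)) (_ : ∀ᶠ j in l, (t : ℝ) ∈ Metric.closedBall (w j) (3 * δ j)),
      Tendsto (fun j => ⨍ y in Metric.closedBall (w j) (δ j), extendZero X y ω) l
        (𝓝 (extendZero X t ω)) := by
    have hq : Measure.QuasiMeasurePreserving (Subtype.val : I → ℝ) volume volume := by
      refine ⟨measurable_subtype_coe, ?_⟩
      rw [show (volume : Measure I) = volume.comap Subtype.val from rfl,
        map_comap_subtype_coe measurableSet_Icc]
      exact Measure.restrict_le_self.absolutelyContinuous
    exact hq.ae h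
  have h0 : ∀ᵐ t : I, t ≠ 0 := by
    rw [ae_iff]; simp
  filter_upwards [h', h0] with t ht ht0
  have ht0 : 0 < t := unitInterval.pos_iff_ne_zero.2 ht0
  choose i hi using fun n : ℕ => exists_mem_mesh (Nat.succ_pos n) ht0
  have hX' : X t ω = extendZero X t ω := by
    unfold extendZero
    rw [Set.indicator_of_mem t.2, Set.projIcc_val]
  rw [hX']
  have := ht (fun n : ℕ => (((i n : ℕ) - 1 / 2) / (n + 1 : ℕ) : ℝ)) (fun n => 1 / 2 / (n + 1 : ℕ))
    ?_ ?_ (l := atTop)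
  · refine this.congr fun n => ?_
    rw [meanProcess_eval_of_mem hX hC (i n) (hi n).1]
    rfl
  · refine tendsto_nhdsWithin_iff.2 ⟨?_, .of_forall fun n => ?_⟩
    · exact (tendsto_add_atTop_iff_nat (f := fun n : ℕ => (1 / 2 / (n : ℝ) : ℝ)) 1).2
        (tendsto_const_div_atTop_nhds_zero_nat _)
    · show (0 : ℝ) < _
      positivity
  · refine .of_forall fun n => ?_
    have h1 := (hi n).2.1
    have h2 := (hi n).2.2
    rw [Real.closedBall_eq_Icc]
    have hn : (0 : ℝ) < (n + 1 : ℕ) := by positivity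
    rw [Set.mem_Icc]
    have e1 : (((i n : ℕ) - 1 / 2) / (n + 1 : ℕ) - 3 * (1 / 2 / (n + 1 : ℕ)) : ℝ) =
      (i n : ℕ) / (n + 1 : ℕ) - 2 / (n + 1 : ℕ) := by ring
    have e2 : (((i n : ℕ) - 1 / 2) / (n + 1 : ℕ) + 3 * (1 / 2 / (n + 1 : ℕ)) : ℝ) =
      ((i n : ℕ) + 1) / (n + 1 : ℕ) := by ring
    rw [e1, e2]
    refine ⟨?_, h2⟩
    have : (0 : ℝ) ≤ 2 / (n + 1 : ℕ) := by positivity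
    linarith

lemma SimpleItoProcess.measurable_eval {𝓕 : Filtration I mΩ} (V : SimpleItoProcess 𝓕) :
    Measurable (fun p : I × Ω => V.eval p.1 p.2) := by
  unfold SimpleItoProcess.eval
  refine Finset.measurable_sum _ fun i _ => ?_
  have : (fun p : I × Ω => (Set.Ioc (V.a i) (V.b i)).indicator (fun _ => V.ξ i p.2) p.1) =
      (Prod.fst ⁻¹' (Set.Ioc (V.a i) (V.b i))).indicator (fun p : I × Ω => V.ξ i p.2) := by
    ext p; simp [Set.indicator]
  rw [this]
  exact (((V.measurable i).mono (𝓕.le _) le_rfl).comp measurable_snd).indicator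
    (measurable_fst measurableSet_Ioc)

/-- Bounded convergence for processes on `[0, 1]`, along almost all times of each path. -/
lemma tendsto_lintegral_sq_sub_of_bounded (P : Measure Ω) [IsFiniteMeasure P]
    {Y : ℕ → I → Ω → ℝ} {X : I → Ω → ℝ} {K : ℝ}
    (hY : ∀ n, Measurable (fun p : I × Ω => Y n p.1 p.2))
    (hX : Measurable (fun p : I × Ω => X p.1 p.2))
    (hb : ∀ n ω, ∀ᵐ t : I, |Y n t ω - X t ω| ≤ K)
    (hlim : ∀ ω, ∀ᵐ t : I, Tendsto (fun n => Y n t ω) atTop (𝓝 (X t ω))) :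
    Tendsto (fun n : ℕ => ∫⁻ t : I, ∫⁻ ω, ‖Y n t ω - X t ω‖ₑ ^ 2 ∂P) atTop (𝓝 0) := by
  have hm (n : ℕ) : Measurable (fun p : I × Ω => ‖Y n p.1 p.2 - X p.1 p.2‖ₑ ^ 2) :=
    (((hY n).sub hX).enorm).pow_const 2
  have hm' (n : ℕ) (ω : Ω) : Measurable (fun t : I => ‖Y n t ω - X t ω‖ₑ ^ 2) :=
    (hm n).comp measurable_prodMk_right
  have hb' (n : ℕ) (ω : Ω) : ∀ᵐ t : I, ‖Y n t ω - X t ω‖ₑ ^ 2 ≤ ENNReal.ofReal K ^ 2 := by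
    filter_upwards [hb n ω] with t ht
    gcongr
    rw [← ofReal_norm]
    exact ENNReal.ofReal_le_ofReal ht
  have hfin : ENNReal.ofReal K ^ 2 ≠ ∞ := ENNReal.pow_ne_top ENNReal.ofReal_ne_top
  have hswap (n : ℕ) := lintegral_lintegral_swap (μ := (volume : Measure I)) (ν := P)
    (f := fun t ω => ‖Y n t ω - X t ω‖ₑ ^ 2) (hm n).aemeasurable
  simp_rw [hswap]
  rw [show (0 : ℝ≥0∞) = ∫⁻ ω, 0 ∂P by simp]
  refine tendsto_lintegral_of_dominated_convergence (fun _ => ENNReal.ofReal K ^ 2)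
    (fun n => (hm n).lintegral_prod_left') (fun n => ae_of_all _ fun ω => ?_) ?_
    (ae_of_all _ fun ω => ?_)
  · refine (lintegral_mono_ae (hb' n ω)).trans ?_
    simp
  · rw [lintegral_const]
    exact ENNReal.mul_ne_top hfin (measure_ne_top _ _)
  · rw [show (0 : ℝ≥0∞) = ∫⁻ t : I, 0 by simp]
    refine tendsto_lintegral_of_dominated_convergence (fun _ => ENNReal.ofReal K ^ 2)
      (fun n => hm' n ω) (fun n => hb' n ω) ?_ ?_
    · rw [lintegral_const]
      exact ENNReal.mul_ne_top hfin (measure_ne_top _ _)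
    · filter_upwards [hlim ω] with t ht
      have := (ENNReal.continuous_pow 2).tendsto _ |>.comp ((ht.sub_const (X t ω)).enorm)
      simpa [Function.comp_def] using this

lemma tendsto_meanProcess {𝓕 : Filtration I mΩ} (P : Measure Ω) [IsFiniteMeasure P]
    {X : I → Ω → ℝ} (hX : IsProgressive 𝓕 X) {C : ℝ} (hC : ∀ t ω, |X t ω| ≤ C) :
    Tendsto (fun n : ℕ => ∫⁻ t : I, ∫⁻ ω, ‖(meanProcess hX hC (n + 1)).eval t ω - X t ω‖ₑ ^ 2 ∂P)
      atTop (𝓝 0) := by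
  refine tendsto_lintegral_sq_sub_of_bounded P (K := C + C)
    (fun n => SimpleItoProcess.measurable_eval _) hX.measurable_uncurry (fun n ω => ?_)
    (ae_tendsto_meanProcess hX hC)
  have h0 : ∀ᵐ t : I, t ≠ 0 := by
    rw [ae_iff]; simp
  filter_upwards [h0] with t ht
  exact (abs_sub _ _).trans (add_le_add (abs_meanProcess_eval_le hX hC n.succ_pos
    (unitInterval.pos_iff_ne_zero.2 ht) ω) (hC t ω))

end Approximation

/-! ### The distance of processes in `L²(dt ⊗ P)` -/

section ProcessDistance

variable {Ω : Type u} [mΩ : MeasurableSpace Ω]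

/-- The distance of two processes in `L²([0, 1] × Ω, dt ⊗ P)`. -/
noncomputable def processDist (P : Measure Ω) (X Y : I → Ω → ℝ) : ℝ≥0∞ :=
  eLpNorm (fun p : I × Ω => X p.1 p.2 - Y p.1 p.2) 2 ((volume : Measure I).prod P)

lemma eLpNorm_two_sq {α : Type*} {m : MeasurableSpace α} (μ : Measure α) (f : α → ℝ) :
    eLpNorm f 2 μ ^ 2 = ∫⁻ x, ‖f x‖ₑ ^ 2 ∂μ := by
  have := eLpNorm_nnreal_pow_eq_lintegral (μ := μ) (f := f) (p := 2) two_ne_zero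
  simpa using this

lemma eLpNorm_two_sq_eq_ofReal {α : Type*} {m : MeasurableSpace α} {μ : Measure α} {f : α → ℝ}
    (hf : MemLp f 2 μ) : eLpNorm f 2 μ ^ 2 = ENNReal.ofReal (∫ x, f x ^ 2 ∂μ) := by
  rw [eLpNorm_two_sq, ofReal_integral_eq_lintegral_ofReal hf.integrable_sq
    (ae_of_all _ fun x => sq_nonneg _)]
  refine lintegral_congr fun x => ?_
  rw [← ofReal_norm, ← ENNReal.ofReal_pow (norm_nonneg _), Real.norm_eq_abs, sq_abs]

variable {P : Measure Ω} {X Y Z : I → Ω → ℝ}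

lemma processDist_sq [SFinite P] (hX : Measurable (fun p : I × Ω => X p.1 p.2))
    (hY : Measurable (fun p : I × Ω => Y p.1 p.2)) :
    processDist P X Y ^ 2 = ∫⁻ t : I, ∫⁻ ω, ‖X t ω - Y t ω‖ₑ ^ 2 ∂P := by
  unfold processDist
  rw [eLpNorm_two_sq, lintegral_prod]
  exact ((hX.sub hY).enorm.pow_const 2).aemeasurable

lemma processDist_comm : processDist P X Y = processDist P Y X := by
  unfold processDist
  rw [← eLpNorm_neg]
  congr 1
  ext p
  simp

lemma processDist_triangle (hX : Measurable (fun p : I × Ω => X p.1 p.2))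
    (hY : Measurable (fun p : I × Ω => Y p.1 p.2)) (hZ : Measurable (fun p : I × Ω => Z p.1 p.2)) :
    processDist P X Z ≤ processDist P X Y + processDist P Y Z := by
  unfold processDist
  refine le_trans (le_of_eq ?_) (eLpNorm_add_le (hX.sub hY).aestronglyMeasurable
    (hY.sub hZ).aestronglyMeasurable (by norm_num))
  congr 1
  ext p
  simp

lemma ENNReal.tendsto_pow_two_zero_iff {ι : Type*} {l : Filter ι} {f : ι → ℝ≥0∞} :
    Tendsto (fun i => f i ^ 2) l (𝓝 0) ↔ Tendsto f l (𝓝 0) := by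
  constructor
  · intro h
    have := ((ENNReal.continuous_rpow_const (y := (1 / 2 : ℝ))).tendsto 0).comp h
    rw [ENNReal.zero_rpow_of_pos (by norm_num)] at this
    refine this.congr fun i => ?_
    rw [Function.comp_apply, ← ENNReal.rpow_natCast, ← ENNReal.rpow_mul]
    norm_num
  · intro h
    have := ((ENNReal.continuous_pow 2).tendsto 0).comp h
    simpa [Function.comp_def] using this

lemma tendsto_processDist_iff [SFinite P] {V : ℕ → I → Ω → ℝ}
    (hV : ∀ k, Measurable (fun p : I × Ω => V k p.1 p.2))
    (hX : Measurable (fun p : I × Ω => X p.1 p.2)) :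
    Tendsto (fun k => ∫⁻ t : I, ∫⁻ ω, ‖V k t ω - X t ω‖ₑ ^ 2 ∂P) atTop (𝓝 0) ↔
      Tendsto (fun k => processDist P (V k) X) atTop (𝓝 0) := by
  simp_rw [← processDist_sq (P := P) (hV _) hX]
  exact ENNReal.tendsto_pow_two_zero_iff

end ProcessDistance

/-! ### Density of the simple processes -/

section Density

variable {Ω : Type u} [mΩ : MeasurableSpace Ω]

lemma MeasureTheory.IsProgressive.comp_measurable {𝓕 : Filtration I mΩ} {X : I → Ω → ℝ}
    (hX : IsProgressive 𝓕 X) {g : ℝ → ℝ} (hg : Measurable g) :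
    IsProgressive 𝓕 (fun t ω => g (X t ω)) :=
  fun i => hg.comp (hX i)

lemma abs_truncate_sub_le (N : ℕ) (x : ℝ) : |max (-N : ℝ) (min x N) - x| ≤ |x| := by
  have hN : (0 : ℝ) ≤ N := N.cast_nonneg
  rcases le_total x N with h | h <;> rcases le_total (-N : ℝ) x with h' | h' <;>
    simp [h, h', abs_le] <;> constructor <;>
    first | nlinarith [abs_nonneg x, le_abs_self x, neg_abs_le x]

lemma tendsto_processDist_truncate {P : Measure Ω} [IsFiniteMeasure P] {X : I → Ω → ℝ}
    (hX : Measurable (fun p : I × Ω => X p.1 p.2))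
    (hX2 : ∫⁻ t : I, ∫⁻ ω, ‖X t ω‖ₑ ^ 2 ∂P < ∞) :
    Tendsto (fun N : ℕ => processDist P (fun t ω => max (-N : ℝ) (min (X t ω) N)) X)
      atTop (𝓝 0) := by
  have hm (N : ℕ) : Measurable (fun p : I × Ω => max (-N : ℝ) (min (X p.1 p.2) N)) :=
    measurable_const.max (hX.min measurable_const)
  rw [← ENNReal.tendsto_pow_two_zero_iff]
  unfold processDist
  simp_rw [eLpNorm_two_sq]
  rw [show (0 : ℝ≥0∞) = ∫⁻ p : I × Ω, 0 ∂((volume : Measure I).prod P) by simp]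
  refine tendsto_lintegral_of_dominated_convergence (fun p => ‖X p.1 p.2‖ₑ ^ 2)
    (fun N => ((hm N).sub hX).enorm.pow_const 2) (fun N => ae_of_all _ fun p => ?_) ?_
    (ae_of_all _ fun p => ?_)
  · exact pow_le_pow_left₀ zero_le (enorm_le_iff_norm_le.2 (abs_truncate_sub_le N (X p.1 p.2))) 2
  · rw [lintegral_prod _ (hX.enorm.pow_const 2).aemeasurable]
    exact hX2.ne
  · refine tendsto_const_nhds.congr' ?_
    obtain ⟨n, hn⟩ := exists_nat_ge |X p.1 p.2|
    filter_upwards [eventually_ge_atTop n] with N hN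
    have hN' : |X p.1 p.2| ≤ N := hn.trans (by exact_mod_cast hN)
    rw [abs_le] at hN'
    rw [min_eq_left hN'.2, max_eq_right hN'.1]
    simp

/-- Simple processes are dense in the space of progressive processes in `L²(dt ⊗ P)`. -/
theorem exists_tendsto_simple {𝓕 : Filtration I mΩ} (P : Measure Ω) [IsFiniteMeasure P]
    {X : I → Ω → ℝ} (hX : IsProgressive 𝓕 X) (hX2 : ∫⁻ t : I, ∫⁻ ω, ‖X t ω‖ₑ ^ 2 ∂P < ∞) :
    ∃ V : ℕ → SimpleItoProcess 𝓕, Tendsto (fun k => processDist P (V k).eval X) atTop (𝓝 0) := by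
  let T (N : ℕ) : I → Ω → ℝ := fun t ω => max (-N : ℝ) (min (X t ω) N)
  have hT (N : ℕ) : IsProgressive 𝓕 (T N) :=
    hX.comp_measurable (g := fun x => max (-N : ℝ) (min x N)) (by fun_prop)
  have hTb (N : ℕ) (t : I) (ω : Ω) : |T N t ω| ≤ N := by
    rw [abs_le]
    exact ⟨le_max_left _ _, max_le (by linarith [N.cast_nonneg (α := ℝ)]) (min_le_right _ _)⟩
  have hV (N : ℕ) : ∃ V : SimpleItoProcess 𝓕, processDist P V.eval (T N) ≤ (N : ℝ≥0∞)⁻¹ := by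
    have h := (tendsto_processDist_iff (fun k => SimpleItoProcess.measurable_eval _)
      (hT N).measurable_uncurry).1 (tendsto_meanProcess P (hT N) (hTb N))
    have hpos : (0 : ℝ≥0∞) < (N : ℝ≥0∞)⁻¹ := by simp
    obtain ⟨k, hk⟩ := (h.eventually (eventually_le_nhds hpos)).exists
    exact ⟨_, hk⟩
  choose V hV using hV
  refine ⟨V, ?_⟩
  have h2 := tendsto_processDist_truncate (P := P) hX.measurable_uncurry hX2
  have h3 := ENNReal.tendsto_inv_nat_nhds_zero.add h2
  rw [add_zero] at h3
  refine tendsto_of_tendsto_of_tendsto_of_le_of_le tendsto_const_nhds h3 (fun _ => zero_le)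
    fun N => ?_
  exact (processDist_triangle (SimpleItoProcess.measurable_eval _) (hT N).measurable_uncurry
    hX.measurable_uncurry).trans (add_le_add_left (hV N) _)

end Density

/-! ### Brownian increments and the completed past -/

section Independence

variable {Ω : Type u}

lemma comap_pi_eq_iSup {ι : Type*} (f : ι → Ω → ℝ) :
    MeasurableSpace.comap (fun ω i => f i ω) MeasurableSpace.pi =
      ⨆ i, MeasurableSpace.comap (f i) inferInstance := by
  simp only [MeasurableSpace.pi, MeasurableSpace.comap_iSup, MeasurableSpace.comap_comp]
  rfl

lemma measurable_increment_comap (B : ℝ≥0 → Ω → ℝ) {a t : ℝ≥0} (ht : a ≤ t) :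
    Measurable[MeasurableSpace.comap (fun ω (t : ℝ≥0) => B (a + t) ω - B a ω)
      MeasurableSpace.pi] (fun ω => B t ω - B a ω) := by
  have h := (measurable_pi_apply (X := fun _ : ℝ≥0 => ℝ) (t - a)).comp
    (comap_measurable (fun ω (t : ℝ≥0) => B (a + t) ω - B a ω))
  simpa [Function.comp_def, add_tsub_cancel_of_le ht] using h

variable [mΩ : MeasurableSpace Ω]

/-- Independence of a σ-field is not affected by null sets. -/
lemma ProbabilityTheory.Indep.eventuallyMeasurableSpace {P : Measure Ω} {m₁ m₂ : MeasurableSpace Ω}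
    (h : Indep m₁ m₂ P) : Indep (eventuallyMeasurableSpace m₁ (ae P)) m₂ P := by
  rw [Indep_iff] at h ⊢
  rintro A C ⟨A', hA', hA⟩ hC
  rw [measure_congr hA, measure_congr (hA.inter (ae_eq_refl C))]
  exact h A' C hA' hC

lemma brownianSigmaUpTo_mono (P : Measure Ω) (B : ℝ≥0 → Ω → ℝ) {s t : ℝ≥0} (h : s ≤ t) :
    brownianSigmaUpTo P B s ≤ brownianSigmaUpTo P B t := by
  rintro A ⟨A', hA', hA⟩
  refine ⟨A', ?_, hA⟩
  have : (⨆ r : Set.Iic s, MeasurableSpace.comap (B r) inferInstance) ≤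
      ⨆ r : Set.Iic t, MeasurableSpace.comap (B r) inferInstance :=
    iSup_le fun r => le_iSup (fun r : Set.Iic t => MeasurableSpace.comap (B r) inferInstance)
      ⟨r.1, le_trans r.2 h⟩
  exact this _ hA'

lemma brownianSigmaUpTo_le (P : Measure Ω) [P.IsComplete] {B : ℝ≥0 → Ω → ℝ}
    (hB : ∀ t, Measurable (B t)) (t : ℝ≥0) : brownianSigmaUpTo P B t ≤ mΩ := by
  rintro A ⟨A', hA', h⟩
  have hle : (⨆ r : Set.Iic t, MeasurableSpace.comap (B r) inferInstance) ≤ mΩ :=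
    iSup_le fun r => (hB r).comap_le
  exact NullMeasurableSet.measurable_of_complete ⟨A', hle _ hA', h⟩

lemma measurable_brownian_upTo (P : Measure Ω) (B : ℝ≥0 → Ω → ℝ) {s t : ℝ≥0} (h : s ≤ t) :
    Measurable[brownianSigmaUpTo P B t] (B s) := by
  have h1 : Measurable[⨆ r : Set.Iic t, MeasurableSpace.comap (B r) inferInstance] (B s) :=
    Measurable.mono (comap_measurable (B s))
      (le_iSup (fun r : Set.Iic t => MeasurableSpace.comap (B r) inferInstance) ⟨s, h⟩) le_rfl
  exact h1.mono le_eventuallyMeasurableSpace le_rfl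

variable {P : Measure Ω} {B : ℝ≥0 → Ω → ℝ}

/-- The increments of Brownian motion after time `a` are independent of the completed past. -/
lemma indep_brownianSigmaUpTo (hB : IsPreBrownianReal B P) (a : ℝ≥0) :
    Indep (brownianSigmaUpTo P B a)
      (MeasurableSpace.comap (fun ω (t : ℝ≥0) => B (a + t) ω - B a ω) MeasurableSpace.pi) P := by
  refine ProbabilityTheory.Indep.eventuallyMeasurableSpace ?_
  have h := (hB.indepFun_shift a).symm
  rw [IndepFun_iff_Indep] at h
  rwa [comap_pi_eq_iSup (fun t : Set.Iic a => B t)] at h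

lemma ProbabilityTheory.IsPreBrownianReal.memLp_sub (hB : IsPreBrownianReal B P) (s t : ℝ≥0) :
    MemLp (fun ω => B s ω - B t ω) 2 P :=
  (hB.isGaussianProcess.hasGaussianLaw_sub (s := s) (t := t)).memLp_two

lemma ProbabilityTheory.IsPreBrownianReal.integral_sub_eq_zero (hB : IsPreBrownianReal B P) (s t : ℝ≥0) :
    ∫ ω, B s ω - B t ω ∂P = 0 := by
  rw [integral_sub (hB.integrable_eval s) (hB.integrable_eval t), hB.integral_eval,
    hB.integral_eval, sub_zero]

lemma ProbabilityTheory.IsPreBrownianReal.integral_increment_mul (hB : IsPreBrownianReal B P) {a s t : ℝ≥0}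
    (hs : a ≤ s) (ht : a ≤ t) :
    ∫ ω, (B s ω - B a ω) * (B t ω - B a ω) ∂P = min (s : ℝ) t - a := by
  have : IsProbabilityMeasure P := hB.isGaussianProcess.isProbabilityMeasure
  have h := (hB.shift a).covariance_fun_eval (s - a) (t - a)
  simp only [add_tsub_cancel_of_le hs, add_tsub_cancel_of_le ht] at h
  rw [covariance_eq_sub (hB.memLp_sub _ _) (hB.memLp_sub _ _), hB.integral_sub_eq_zero,
    zero_mul, sub_zero] at h
  rw [show (∫ ω, (B s ω - B a ω) * (B t ω - B a ω) ∂P) = _ from h]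
  rw [NNReal.coe_min, NNReal.coe_sub hs, NNReal.coe_sub ht, min_sub_sub_right]

variable [P.IsComplete]

lemma integral_mul_of_measurable_increments (hBm : ∀ t, Measurable (B t))
    (hB : IsPreBrownianReal B P) {a : ℝ≥0} {η g : Ω → ℝ}
    (hη : Measurable[brownianSigmaUpTo P B a] η)
    (hg : Measurable[MeasurableSpace.comap (fun ω (t : ℝ≥0) => B (a + t) ω - B a ω)
      MeasurableSpace.pi] g) :
    ∫ ω, η ω * g ω ∂P = (∫ ω, η ω ∂P) * ∫ ω, g ω ∂P := by
  have hind : IndepFun η g P := by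
    rw [IndepFun_iff_Indep]
    exact indep_of_indep_of_le_left (indep_of_indep_of_le_right (indep_brownianSigmaUpTo hB a)
      hg.comap_le) hη.comap_le
  have hsh : Measurable (fun ω (t : ℝ≥0) => B (a + t) ω - B a ω) :=
    measurable_pi_lambda _ fun t => (hBm _).sub (hBm _)
  exact hind.integral_fun_mul_eq_mul_integral
    (hη.mono (brownianSigmaUpTo_le P hBm a) le_rfl).aestronglyMeasurable
    (hg.mono hsh.comap_le le_rfl).aestronglyMeasurable

lemma integral_mul_increment (hBm : ∀ t, Measurable (B t))
    (hB : IsPreBrownianReal B P) {a t : ℝ≥0} (ht : a ≤ t) {η : Ω → ℝ}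
    (hη : Measurable[brownianSigmaUpTo P B a] η) :
    ∫ ω, η ω * (B t ω - B a ω) ∂P = 0 := by
  rw [integral_mul_of_measurable_increments hBm hB hη (measurable_increment_comap B ht),
    hB.integral_sub_eq_zero, mul_zero]

lemma integral_mul_increment_mul_increment (hBm : ∀ t, Measurable (B t))
    (hB : IsPreBrownianReal B P) {a s t : ℝ≥0} (hs : a ≤ s) (ht : a ≤ t) {η : Ω → ℝ}
    (hη : Measurable[brownianSigmaUpTo P B a] η) :
    ∫ ω, η ω * ((B s ω - B a ω) * (B t ω - B a ω)) ∂P =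
      (∫ ω, η ω ∂P) * (min (s : ℝ) t - a) := by
  rw [← hB.integral_increment_mul hs ht]
  exact integral_mul_of_measurable_increments hBm hB hη
    ((measurable_increment_comap B hs).mul (measurable_increment_comap B ht))

end Independence

/-! ### The Itô isometry -/

section Isometry

lemma integral_sub_sq {α : Type*} {m : MeasurableSpace α} {μ : Measure α} {f g : α → ℝ}
    (hf : MemLp f 2 μ) (hg : MemLp g 2 μ) :
    ∫ x, (f x - g x) ^ 2 ∂μ =
      ∫ x, f x * f x ∂μ - 2 * ∫ x, f x * g x ∂μ + ∫ x, g x * g x ∂μ := by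
  have h1 : Integrable (fun x => f x * f x) μ := hf.integrable_mul hf
  have h2 : Integrable (fun x => 2 * (f x * g x)) μ := (hf.integrable_mul hg).const_mul 2
  have h3 : Integrable (fun x => g x * g x) μ := hg.integrable_mul hg
  have h12 : Integrable (fun x => f x * f x - 2 * (f x * g x)) μ := h1.sub h2
  rw [← integral_const_mul, ← integral_sub h1 h2, ← integral_add h12 h3]
  refine integral_congr_ae (ae_of_all _ fun x => ?_)
  simp only
  ring

lemma integral_sum_mul_sum {α ι κ : Type*} [Fintype ι] [Fintype κ] {m : MeasurableSpace α}
    {μ : Measure α} {f : ι → α → ℝ} {g : κ → α → ℝ} (hf : ∀ i, MemLp (f i) 2 μ)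
    (hg : ∀ j, MemLp (g j) 2 μ) :
    ∫ x, (∑ i, f i x) * (∑ j, g j x) ∂μ = ∑ i, ∑ j, ∫ x, f i x * g j x ∂μ := by
  have h (i : ι) (j : κ) : Integrable (fun x => f i x * g j x) μ := (hf i).integrable_mul (hg j)
  simp_rw [Finset.sum_mul_sum]
  rw [integral_finsetSum _ fun i _ => integrable_finsetSum _ fun j _ => h i j]
  exact Finset.sum_congr rfl fun i _ => integral_finsetSum _ fun j _ => h i j

variable {Ω : Type u} [mΩ : MeasurableSpace Ω] {P : Measure Ω} {B : ℝ≥0 → Ω → ℝ}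

lemma integrable_bdd_mul_increments (hB : IsPreBrownianReal B P) {η : Ω → ℝ}
    (hη : Measurable η) {C : ℝ} (hC : ∀ ω, |η ω| ≤ C) (a b c d : ℝ≥0) :
    Integrable (fun ω => η ω * ((B b ω - B a ω) * (B d ω - B c ω))) P :=
  ((hB.memLp_sub b a).integrable_mul (hB.memLp_sub d c)).bdd_mul hη.aestronglyMeasurable
    (ae_of_all _ hC)

lemma SimpleItoProcess.memLp_eval {𝓕 : Filtration I mΩ} [IsFiniteMeasure P]
    (V : SimpleItoProcess 𝓕) :
    MemLp (fun p : I × Ω => V.eval p.1 p.2) 2 ((volume : Measure I).prod P) := by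
  choose C hC using V.bounded
  refine MemLp.of_bound V.measurable_eval.aestronglyMeasurable (∑ i, C i) (ae_of_all _ fun p => ?_)
  unfold SimpleItoProcess.eval
  refine (norm_sum_le _ _).trans (Finset.sum_le_sum fun i _ => ?_)
  exact (norm_indicator_le_norm_self _ _).trans (hC i p.2)

lemma integral_prod_indicator_mul_indicator [SFinite P] (a b c d : I) (ξ η : Ω → ℝ) :
    ∫ p : I × Ω, (Set.Ioc a b).indicator (fun _ => ξ p.2) p.1 *
      (Set.Ioc c d).indicator (fun _ => η p.2) p.1 ∂((volume : Measure I).prod P) =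
      max 0 (min (b : ℝ) d - max (a : ℝ) c) * ∫ ω, ξ ω * η ω ∂P := by
  have h (p : I × Ω) : (Set.Ioc a b).indicator (fun _ => ξ p.2) p.1 *
      (Set.Ioc c d).indicator (fun _ => η p.2) p.1 =
      (Set.Ioc (max a c) (min b d)).indicator (fun _ => (1 : ℝ)) p.1 * (ξ p.2 * η p.2) := by
    rw [← Set.Ioc_inter_Ioc]
    by_cases h1 : p.1 ∈ Set.Ioc a b <;> by_cases h2 : p.1 ∈ Set.Ioc c d <;>
      simp [Set.indicator, h1, h2, -Set.mem_Ioc]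
  simp_rw [h]
  rw [integral_prod_mul (fun t : I => (Set.Ioc (max a c) (min b d)).indicator (fun _ => (1 : ℝ)) t)
    (fun ω => ξ ω * η ω), integral_indicator measurableSet_Ioc]
  congr 1
  simp only [integral_const, smul_eq_mul, mul_one, measureReal_def, Measure.restrict_apply_univ]
  rw [unitInterval.volume_Ioc, ENNReal.toReal_ofReal', max_comm]
  rfl

variable [P.IsComplete]

/-- The Itô isometry for a pair of summands of simple processes: the first factor on the right is
the length of the intersection of `(a, b]` and `(c, d]`. -/
lemma integral_coeff_mul_increments (hBm : ∀ t, Measurable (B t)) (hB : IsPreBrownianReal B P)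
    {a b c d : ℝ≥0} (hab : a ≤ b) (hcd : c ≤ d) {ξ η : Ω → ℝ}
    (hξ : Measurable[brownianSigmaUpTo P B a] ξ) (hη : Measurable[brownianSigmaUpTo P B c] η)
    {C D : ℝ} (hC : ∀ ω, |ξ ω| ≤ C) (hD : ∀ ω, |η ω| ≤ D) :
    ∫ ω, (ξ ω * (B b ω - B a ω)) * (η ω * (B d ω - B c ω)) ∂P =
      max 0 (min (b : ℝ) d - max (a : ℝ) c) * ∫ ω, ξ ω * η ω ∂P := by
  wlog hac : a ≤ c generalizing a b c d ξ η C D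
  · rw [min_comm, max_comm (a : ℝ)]
    simp_rw [mul_comm (ξ _) (η _)]
    rw [← this hcd hab hη hξ hD hC (le_of_not_ge hac)]
    refine integral_congr_ae (ae_of_all _ fun ω => ?_)
    ring
  have hξ' := hξ.mono (brownianSigmaUpTo_mono P B hac) le_rfl
  have hξη : Measurable[brownianSigmaUpTo P B c] (fun ω => ξ ω * η ω) := hξ'.mul hη
  have hξηm := hξη.mono (brownianSigmaUpTo_le P hBm c) le_rfl
  have hbd (ω : Ω) : |ξ ω * η ω| ≤ C * D := by
    rw [abs_mul]
    exact mul_le_mul (hC ω) (hD ω) (abs_nonneg _) ((abs_nonneg _).trans (hC ω))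
  -- the part of the first increment up to time `c` is known at time `c`
  have hsplit (ω : Ω) : (ξ ω * (B b ω - B a ω)) * (η ω * (B d ω - B c ω)) =
      (ξ ω * η ω) * ((B (min b c) ω - B a ω) * (B d ω - B c ω)) +
      (ξ ω * η ω) * ((B (max b c) ω - B c ω) * (B d ω - B c ω)) := by
    rcases le_total b c with h | h
    · rw [min_eq_left h, max_eq_right h]; ring
    · rw [min_eq_right h, max_eq_left h]; ring
  simp_rw [hsplit]
  rw [integral_add (integrable_bdd_mul_increments hB hξηm hbd _ _ _ _)
    (integrable_bdd_mul_increments hB hξηm hbd _ _ _ _),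
    integral_mul_increment_mul_increment hBm hB (le_max_right b c) hcd hξη]
  have h0 : ∫ ω, (ξ ω * η ω) * ((B (min b c) ω - B a ω) * (B d ω - B c ω)) ∂P = 0 := by
    simp_rw [← mul_assoc]
    refine integral_mul_increment hBm hB hcd ?_
    exact hξη.mul ((measurable_brownian_upTo P B (min_le_right b c)).sub
      (measurable_brownian_upTo P B hac))
  rw [h0, zero_add, mul_comm]
  congr 1
  have h1 : (a : ℝ) ≤ c := hac
  have h2 : (c : ℝ) ≤ d := hcd
  rw [max_eq_right h1, NNReal.coe_max]
  rcases le_total (b : ℝ) c with h | h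
  · rw [max_eq_right h, min_eq_left h2, max_eq_left]
    · ring
    · linarith [min_le_left (b : ℝ) d]
  · rw [max_eq_left h, max_eq_right]
    linarith [le_min h h2]

variable {hBm : ∀ t, Measurable (B t)}

lemma SimpleItoProcess.memLp_integral [IsFiniteMeasure P] (hB : IsPreBrownianReal B P)
    (V : SimpleItoProcess (brownianFiltration P B hBm)) : MemLp (V.integral B) 2 P := by
  unfold SimpleItoProcess.integral
  refine memLp_finsetSum _ fun i _ => ?_
  obtain ⟨C, hC⟩ := V.bounded i
  have hm : Measurable (V.ξ i) := (V.measurable i).mono ((brownianFiltration P B hBm).le _) le_rfl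
  exact (hB.memLp_sub _ _).mul (r := 2) (MemLp.of_bound (p := ∞) hm.aestronglyMeasurable C (ae_of_all _ hC))

/-- The bilinear Itô isometry for simple processes. The intervals of a simple process may
overlap, which is why it is stated for pairs of summands. -/
lemma SimpleItoProcess.integral_mul_integral [IsFiniteMeasure P] (hB : IsPreBrownianReal B P)
    (V W : SimpleItoProcess (brownianFiltration P B hBm)) :
    ∫ ω, V.integral B ω * W.integral B ω ∂P =
      ∫ p : I × Ω, V.eval p.1 p.2 * W.eval p.1 p.2 ∂((volume : Measure I).prod P) := by
  choose C hC using V.bounded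
  choose D hD using W.bounded
  have hV (i) : Measurable (V.ξ i) := (V.measurable i).mono ((brownianFiltration P B hBm).le _) le_rfl
  have hW (i) : Measurable (W.ξ i) := (W.measurable i).mono ((brownianFiltration P B hBm).le _) le_rfl
  have hVi (i) : MemLp (fun ω => V.ξ i ω * (B (unitInterval.toNNReal (V.b i)) ω -
      B (unitInterval.toNNReal (V.a i)) ω)) 2 P :=
    (hB.memLp_sub _ _).mul (r := 2)
      (MemLp.of_bound (p := ∞) (hV i).aestronglyMeasurable (C i) (ae_of_all _ (hC i)))
  have hWi (i) : MemLp (fun ω => W.ξ i ω * (B (unitInterval.toNNReal (W.b i)) ω -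
      B (unitInterval.toNNReal (W.a i)) ω)) 2 P :=
    (hB.memLp_sub _ _).mul (r := 2)
      (MemLp.of_bound (p := ∞) (hW i).aestronglyMeasurable (D i) (ae_of_all _ (hD i)))
  have hmem {ξ : Ω → ℝ} (hξ : Measurable ξ) {K : ℝ} (hK : ∀ ω, |ξ ω| ≤ K) (a b : I) :
      MemLp (fun p : I × Ω => (Set.Ioc a b).indicator (fun _ => ξ p.2) p.1) 2
        ((volume : Measure I).prod P) := by
    refine MemLp.of_bound (Measurable.aestronglyMeasurable ?_) K (ae_of_all _ fun p =>
      (norm_indicator_le_norm_self _ _).trans (hK p.2))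
    have : (fun p : I × Ω => (Set.Ioc a b).indicator (fun _ => ξ p.2) p.1) =
        (Prod.fst ⁻¹' (Set.Ioc a b)).indicator (fun p : I × Ω => ξ p.2) := by
      ext p; simp [Set.indicator]
    rw [this]
    exact (hξ.comp measurable_snd).indicator (measurable_fst measurableSet_Ioc)
  unfold SimpleItoProcess.integral SimpleItoProcess.eval
  rw [integral_sum_mul_sum hVi hWi,
    integral_sum_mul_sum (fun i => hmem (hV i) (hC i) _ _) (fun j => hmem (hW j) (hD j) _ _)]
  refine Finset.sum_congr rfl fun i _ => Finset.sum_congr rfl fun j _ => ?_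
  rw [integral_prod_indicator_mul_indicator]
  exact integral_coeff_mul_increments hBm hB (V.le i) (W.le j) (V.measurable i) (W.measurable j)
    (hC i) (hD j)

/-- The Itô isometry for the difference of two simple processes. -/
lemma SimpleItoProcess.eLpNorm_integral_sub [IsFiniteMeasure P] (hB : IsPreBrownianReal B P)
    (V W : SimpleItoProcess (brownianFiltration P B hBm)) :
    eLpNorm (fun ω => V.integral B ω - W.integral B ω) 2 P = processDist P V.eval W.eval := by
  have hV := V.memLp_integral hB
  have hW := W.memLp_integral hB
  have hVe := V.memLp_eval (P := P)
  have hWe := W.memLp_eval (P := P)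
  have hinj : Function.Injective (fun x : ℝ≥0∞ => x ^ 2) :=
    (ENNReal.pow_right_strictMono two_ne_zero).injective
  refine hinj ?_
  refine (eLpNorm_two_sq_eq_ofReal (hV.sub hW)).trans
    (Eq.trans ?_ (eLpNorm_two_sq_eq_ofReal (hVe.sub hWe)).symm)
  congr 1
  simp only [Pi.sub_apply]
  rw [integral_sub_sq hV hW, integral_sub_sq hVe hWe, V.integral_mul_integral hB,
    V.integral_mul_integral hB, W.integral_mul_integral hB]

end Isometry

/-! ### Existence and contractivity of the Itô integral -/

section ItoIntegral

variable {Ω : Type u} [mΩ : MeasurableSpace Ω] {P : Measure Ω} [IsFiniteMeasure P] [P.IsComplete]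
  {B : ℝ≥0 → Ω → ℝ} {hBm : ∀ t, Measurable (B t)}

/-- The elementary integrals of an `L²(dt ⊗ P)`-convergent sequence of simple processes converge
in `L²(P)`. -/
lemma exists_tendsto_integral (hB : IsPreBrownianReal B P) {X : I → Ω → ℝ}
    (hX : Measurable (fun p : I × Ω => X p.1 p.2))
    {V : ℕ → SimpleItoProcess (brownianFiltration P B hBm)}
    (hV : Tendsto (fun k => processDist P (V k).eval X) atTop (𝓝 0)) :
    ∃ Y : Ω → ℝ, MemLp Y 2 P ∧
      Tendsto (fun k => eLpNorm (fun ω => (V k).integral B ω - Y ω) 2 P) atTop (𝓝 0) := by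
  have hL (k : ℕ) := (V k).memLp_integral hB
  let f (k : ℕ) : Lp ℝ 2 P := (hL k).toLp
  have hdist (k l : ℕ) : edist (f k) (f l) ≤
      processDist P (V k).eval X + processDist P (V l).eval X := by
    rw [Lp.edist_toLp_toLp]
    refine ((V k).eLpNorm_integral_sub hB (V l)).trans_le ?_
    rw [processDist_comm (X := (V l).eval)]
    exact processDist_triangle (V k).measurable_eval hX (V l).measurable_eval
  have hc : CauchySeq f := by
    rw [EMetric.cauchySeq_iff]
    intro ε hε
    obtain ⟨N, hN⟩ := (hV.eventually (gt_mem_nhds (ENNReal.half_pos hε.ne'))).exists_forall_of_atTop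
    refine ⟨N, fun k hk l hl => (hdist k l).trans_lt ?_⟩
    calc _ < ε / 2 + ε / 2 := ENNReal.add_lt_add (hN k hk) (hN l hl)
      _ = ε := ENNReal.add_halves ε
  obtain ⟨g, hg⟩ := cauchySeq_tendsto_of_complete hc
  refine ⟨g, Lp.memLp g, ?_⟩
  rw [tendsto_iff_edist_tendsto_0] at hg
  refine hg.congr fun k => ?_
  rw [Lp.edist_def]
  refine eLpNorm_congr_ae ?_
  filter_upwards [(hL k).coeFn_toLp] with ω hω
  simp [f, hω]

/-- Processes in the `L²(dt ⊗ P)`-closure of the simple processes have an Itô integral. -/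
lemma exists_isItoIntegral_of_tendsto (hB : IsPreBrownianReal B P) {X : I → Ω → ℝ}
    (hX : Measurable (fun p : I × Ω => X p.1 p.2))
    {V : ℕ → SimpleItoProcess (brownianFiltration P B hBm)}
    (hV : Tendsto (fun k => processDist P (V k).eval X) atTop (𝓝 0)) :
    ∃ Y, IsItoIntegral P (brownianFiltration P B hBm) B X Y := by
  obtain ⟨Y, hY, h⟩ := exists_tendsto_integral hB hX hV
  exact ⟨Y, hY, V, (tendsto_processDist_iff (fun k => (V k).measurable_eval) hX).2 hV, h⟩

theorem exists_isItoIntegral (hB : IsPreBrownianReal B P) {X : I → Ω → ℝ}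
    (hX : IsProgressive (brownianFiltration P B hBm) X)
    (hX2 : ∫⁻ t : I, ∫⁻ ω, ‖X t ω‖ₑ ^ 2 ∂P < ∞) :
    ∃ Y, IsItoIntegral P (brownianFiltration P B hBm) B X Y := by
  obtain ⟨V, hV⟩ := exists_tendsto_simple P hX hX2
  exact exists_isItoIntegral_of_tendsto hB hX.measurable_uncurry hV

/-- The Itô integral is a contraction from `L²(dt ⊗ P)` to `L²(P)`. -/
lemma IsItoIntegral.eLpNorm_sub_le (hB : IsPreBrownianReal B P) {X X' : I → Ω → ℝ}
    {Y Y' : Ω → ℝ} (hX : Measurable (fun p : I × Ω => X p.1 p.2))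
    (hX' : Measurable (fun p : I × Ω => X' p.1 p.2))
    (h : IsItoIntegral P (brownianFiltration P B hBm) B X Y)
    (h' : IsItoIntegral P (brownianFiltration P B hBm) B X' Y') :
    eLpNorm (fun ω => Y ω - Y' ω) 2 P ≤ processDist P X X' := by
  obtain ⟨hY, V, hV, hVY⟩ := h
  obtain ⟨hY', V', hV', hVY'⟩ := h'
  rw [tendsto_processDist_iff (fun k => (V k).measurable_eval) hX] at hV
  rw [tendsto_processDist_iff (fun k => (V' k).measurable_eval) hX'] at hV'
  have hlim := (((hVY.add hV).add tendsto_const_nhds).add hV').add hVY'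
    (f := fun k => _ + processDist P X X' + _)
  rw [zero_add, zero_add, add_zero, add_zero] at hlim
  refine ge_of_tendsto' hlim fun k => ?_
  have hm := (V k).memLp_integral hB
  have hm' := (V' k).memLp_integral hB
  have e : (fun ω => Y ω - Y' ω) = (fun ω => -((V k).integral B ω - Y ω)) +
      (fun ω => (V k).integral B ω - (V' k).integral B ω) +
      (fun ω => (V' k).integral B ω - Y' ω) := by
    ext ω; simp
  have h1 : eLpNorm (fun ω => -((V k).integral B ω - Y ω)) 2 P =
      eLpNorm (fun ω => (V k).integral B ω - Y ω) 2 P := eLpNorm_neg _ _ _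
  have h2 : eLpNorm (fun ω => (V k).integral B ω - (V' k).integral B ω) 2 P ≤
      processDist P (V k).eval X + processDist P X X' + processDist P (V' k).eval X' := by
    rw [(V k).eLpNorm_integral_sub hB (V' k), processDist_comm (X := (V' k).eval)]
    exact (processDist_triangle (V k).measurable_eval hX' (V' k).measurable_eval).trans
      (add_le_add_left (processDist_triangle (V k).measurable_eval hX hX') _)
  rw [e]
  calc _ ≤ _ := (eLpNorm_add_le ((hm.sub hY).neg.add (hm.sub hm')).aestronglyMeasurable
        (hm'.sub hY').aestronglyMeasurable (by norm_num)).trans (add_le_add_left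
          (eLpNorm_add_le (hm.sub hY).neg.aestronglyMeasurable
            (hm.sub hm').aestronglyMeasurable (by norm_num)) _)
    _ ≤ _ := add_le_add_left (add_le_add h1.le h2) _
    _ = _ := by
      rw [show (V' k).integral B - Y' = fun ω => (V' k).integral B ω - Y' ω from rfl]
      ring

end ItoIntegral

/-! ### Restriction of simple processes to `(δ, 1]` -/

section Restrict

variable {Ω : Type u} [mΩ : MeasurableSpace Ω] {𝓕 : Filtration I mΩ}

/-- The simple process `v * 1_{(δ, 1]} * V`, where `v` is bounded and measurable at time `δ`. -/
noncomputable def SimpleItoProcess.restrictMul (V : SimpleItoProcess 𝓕) (δ : I) {v : Ω → ℝ}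
    (hv : Measurable[𝓕 δ] v) (hvb : ∃ C : ℝ, ∀ ω, |v ω| ≤ C) : SimpleItoProcess 𝓕 where
  size := V.size
  a i := max (V.a i) δ
  b i := max (V.b i) δ
  le i := max_le_max_right _ (V.le i)
  ξ i ω := v ω * V.ξ i ω
  measurable i := Measurable.mul (m := 𝓕 (max (V.a i) δ))
    (hv.mono (𝓕.mono (le_max_right _ _)) le_rfl)
    ((V.measurable i).mono (𝓕.mono (le_max_left _ _)) le_rfl)
  bounded i := by
    obtain ⟨C, hC⟩ := V.bounded i
    obtain ⟨D, hD⟩ := hvb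
    refine ⟨D * C, fun ω => ?_⟩
    rw [abs_mul]
    exact mul_le_mul (hD ω) (hC ω) (abs_nonneg _) ((abs_nonneg _).trans (hD ω))

variable (V : SimpleItoProcess 𝓕) (δ : I)

lemma SimpleItoProcess.eval_restrictMul {v : Ω → ℝ}
    (hv : Measurable[𝓕 δ] v) (hvb : ∃ C : ℝ, ∀ ω, |v ω| ≤ C) (t : I) (ω : Ω) :
    (V.restrictMul δ hv hvb).eval t ω = (Set.Ioi δ).indicator (fun t => V.eval t ω) t * v ω := by
  have h (i : Fin V.size) : t ∈ Set.Ioc (max (V.a i) δ) (max (V.b i) δ) ↔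
      t ∈ Set.Ioi δ ∧ t ∈ Set.Ioc (V.a i) (V.b i) := by
    simp only [Set.mem_Ioc, Set.mem_Ioi, max_lt_iff, le_max_iff]
    constructor
    · rintro ⟨⟨h1, h2⟩, h3⟩
      exact ⟨h2, h1, h3.resolve_right (not_le.2 h2)⟩
    · rintro ⟨h1, h2, h3⟩
      exact ⟨⟨h2, h1⟩, Or.inl h3⟩
  by_cases ht : t ∈ Set.Ioi δ
  · rw [Set.indicator_of_mem ht]
    unfold SimpleItoProcess.eval
    rw [Finset.sum_mul]
    refine Finset.sum_congr rfl fun i _ => ?_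
    simp only [restrictMul]
    by_cases hi : t ∈ Set.Ioc (V.a i) (V.b i)
    · rw [Set.indicator_of_mem ((h i).2 ⟨ht, hi⟩), Set.indicator_of_mem hi, mul_comm]
    · rw [Set.indicator_of_notMem (fun h' => hi ((h i).1 h').2), Set.indicator_of_notMem hi,
        zero_mul]
  · rw [Set.indicator_of_notMem ht, zero_mul]
    unfold SimpleItoProcess.eval
    exact Finset.sum_eq_zero fun i _ =>
      Set.indicator_of_notMem (fun h' => ht ((h i).1 h').1) _

/-- The simple process `1_{(δ, 1]} * V`. -/
noncomputable def SimpleItoProcess.restrict : SimpleItoProcess 𝓕 :=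
  V.restrictMul δ (v := fun _ => 1) measurable_const ⟨1, fun _ => by simp⟩

lemma SimpleItoProcess.integral_restrictMul (B : ℝ≥0 → Ω → ℝ) {v : Ω → ℝ}
    (hv : Measurable[𝓕 δ] v) (hvb : ∃ C : ℝ, ∀ ω, |v ω| ≤ C) (ω : Ω) :
    (V.restrictMul δ hv hvb).integral B ω = v ω * (V.restrict δ).integral B ω := by
  unfold SimpleItoProcess.integral
  rw [Finset.mul_sum]
  refine Finset.sum_congr rfl fun i _ => ?_
  simp only [SimpleItoProcess.restrict, SimpleItoProcess.restrictMul]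
  ring

end Restrict

/-! ### Wiener integrals -/

section Wiener

variable {Ω : Type u} [mΩ : MeasurableSpace Ω]

lemma tendsto_eLpNorm_mul_bounded {α : Type*} {m : MeasurableSpace α} {μ : Measure α}
    {f : ℕ → α → ℝ} {v : α → ℝ} {C : ℝ} (hv : ∀ x, |v x| ≤ C)
    (h : Tendsto (fun k => eLpNorm (f k) 2 μ) atTop (𝓝 0)) :
    Tendsto (fun k => eLpNorm (fun x => v x * f k x) 2 μ) atTop (𝓝 0) := by
  have h2 := ENNReal.Tendsto.const_mul (a := ENNReal.ofReal C) h (Or.inr ENNReal.ofReal_ne_top)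
  rw [mul_zero] at h2
  refine tendsto_of_tendsto_of_tendsto_of_le_of_le tendsto_const_nhds h2 (fun _ => zero_le)
    fun k => ?_
  refine eLpNorm_le_mul_eLpNorm_of_ae_le_mul (ae_of_all _ fun x => ?_) 2
  rw [norm_mul]
  exact mul_le_mul_of_nonneg_right (hv x) (norm_nonneg _)

lemma isProgressive_deterministic (𝓕 : Filtration I mΩ) {φ : I → ℝ} (hφ : Measurable φ) :
    IsProgressive 𝓕 (fun t (_ : Ω) => φ t) :=
  fun _ => hφ.comp (measurable_subtype_coe.comp measurable_fst)

/-- The Wiener integral `G` of `1_{(δ, 1]} φ`, as a limit of elementary integrals with deterministic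
coefficients over time intervals contained in `[δ, 1]`; a bounded factor known at time `δ` may be
pulled out of the Itô integral. -/
theorem exists_wienerIntegral {P : Measure Ω} [IsFiniteMeasure P] [P.IsComplete]
    {B : ℝ≥0 → Ω → ℝ} {hBm : ∀ t, Measurable (B t)} (hB : IsPreBrownianReal B P)
    {φ : I → ℝ} (hφ : Measurable φ) {C : ℝ} (hC : ∀ t, |φ t| ≤ C) (δ : I) :
    ∃ G : Ω → ℝ, MemLp G 2 P ∧
      (∀ v : Ω → ℝ, Measurable[brownianFiltration P B hBm δ] v → (∃ D : ℝ, ∀ ω, |v ω| ≤ D) →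
        IsItoIntegral P (brownianFiltration P B hBm) B
          (fun t ω => (Set.Ioi δ).indicator φ t * v ω) (fun ω => v ω * G ω)) ∧
      ∃ V : ℕ → SimpleItoProcess (brownianFiltration P B hBm),
        (∀ k i, δ ≤ (V k).a i) ∧ (∀ k i, ∃ c : ℝ, ∀ ω, (V k).ξ i ω = c) ∧
        Tendsto (fun k => processDist P (V k).eval (fun t _ => (Set.Ioi δ).indicator φ t))
          atTop (𝓝 0) ∧
        Tendsto (fun k => eLpNorm (fun ω => (V k).integral B ω - G ω) 2 P) atTop (𝓝 0) := by
  have hprog := isProgressive_deterministic (brownianFiltration P B hBm) hφ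
  let W (k : ℕ) : SimpleItoProcess (brownianFiltration P B hBm) :=
    meanProcess hprog (C := C) (fun t _ => hC t) (k + 1)
  have hW : Tendsto (fun k => processDist P (W k).eval (fun t _ => φ t)) atTop (𝓝 0) :=
    (tendsto_processDist_iff (fun k => (W k).measurable_eval) hprog.measurable_uncurry).1
      (tendsto_meanProcess P hprog (fun t _ => hC t))
  have hφδ : Measurable ((Set.Ioi δ).indicator φ) := hφ.indicator measurableSet_Ioi
  -- restriction to `(δ, 1]` and multiplication by a bounded variable are continuous
  have hmul (v : Ω → ℝ) (hv : Measurable[brownianFiltration P B hBm δ] v)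
      (hvb : ∃ D : ℝ, ∀ ω, |v ω| ≤ D) :
      Tendsto (fun k => processDist P ((W k).restrictMul δ hv hvb).eval
        (fun t ω => (Set.Ioi δ).indicator φ t * v ω)) atTop (𝓝 0) := by
    obtain ⟨D, hD⟩ := id hvb
    unfold processDist at hW ⊢
    have := tendsto_eLpNorm_mul_bounded (C := D)
      (v := fun p : I × Ω => (Set.Ioi δ).indicator (fun _ => v p.2) p.1)
      (fun p => (norm_indicator_le_norm_self (fun _ => v p.2) p.1).trans (hD p.2)) hW
    refine this.congr fun k => ?_
    congr 1
    ext p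
    rw [SimpleItoProcess.eval_restrictMul]
    by_cases hp : p.1 ∈ Set.Ioi δ
    · simp only [Set.indicator_of_mem hp]; ring
    · simp only [Set.indicator_of_notMem hp]; ring
  have hone : Tendsto (fun k => processDist P ((W k).restrict δ).eval
      (fun t _ => (Set.Ioi δ).indicator φ t)) atTop (𝓝 0) := by
    have := hmul (fun _ => 1) measurable_const ⟨1, fun _ => by simp⟩
    simp only [mul_one] at this
    exact this
  obtain ⟨G, hG, hGlim⟩ := exists_tendsto_integral hB (hφδ.comp measurable_fst) hone
  refine ⟨G, hG, fun v hv hvb => ?_, fun k => (W k).restrict δ, fun k i => le_max_right _ _,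
    fun k i => ?_, hone, hGlim⟩
  · have hvm : Measurable v := hv.mono ((brownianFiltration P B hBm).le δ) le_rfl
    obtain ⟨D, hD⟩ := id hvb
    refine ⟨hG.mul (r := 2) (MemLp.of_bound (p := ∞) hvm.aestronglyMeasurable D (ae_of_all _ hD)),
      fun k => (W k).restrictMul δ hv hvb, ?_, ?_⟩
    · refine (tendsto_processDist_iff (fun k => SimpleItoProcess.measurable_eval _) ?_).2
        (hmul v hv hvb)
      exact (hφδ.comp measurable_fst).mul (hvm.comp measurable_snd)
    · refine (tendsto_eLpNorm_mul_bounded hD hGlim).congr fun k => ?_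
      congr 1
      ext ω
      rw [SimpleItoProcess.integral_restrictMul]
      ring
  · by_cases hΩ : Nonempty Ω
    · refine ⟨((W k).restrict δ).ξ i hΩ.some, fun ω => rfl⟩
    · exact ⟨0, fun ω => absurd ⟨ω⟩ hΩ⟩

end Wiener

/-! ### Characteristic functionals -/

section CharacteristicFunction

variable {Ω : Type u} [mΩ : MeasurableSpace Ω] {P : Measure Ω}

lemma norm_exp_I_mul_sub_le (x y : ℝ) :
    ‖Complex.exp (Complex.I * (x : ℝ)) - Complex.exp (Complex.I * (y : ℝ))‖ ≤ |x - y| := by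
  have h : Complex.exp (Complex.I * (x : ℝ)) - Complex.exp (Complex.I * (y : ℝ)) =
      Complex.exp (Complex.I * (y : ℝ)) * (Complex.exp (Complex.I * ((x - y : ℝ) : ℂ)) - 1) := by
    rw [mul_sub, ← Complex.exp_add, mul_one]
    push_cast
    ring_nf
  rw [h, norm_mul, Complex.norm_exp_I_mul_ofReal, one_mul]
  exact Real.norm_exp_I_mul_ofReal_sub_one_le

lemma aestronglyMeasurable_exp_I_mul {F : Ω → ℝ} (hF : AEMeasurable F P) (r : ℝ) :
    AEStronglyMeasurable (fun ω => Complex.exp (Complex.I * (r * F ω : ℝ))) P := by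
  have : Continuous (fun x : ℝ => Complex.exp (Complex.I * (r * x : ℝ))) := by fun_prop
  exact this.comp_aestronglyMeasurable hF.aestronglyMeasurable

lemma integrable_mul_exp_I_mul {Y F : Ω → ℝ} (hY : Integrable Y P) (hF : AEMeasurable F P)
    (r : ℝ) : Integrable (fun ω => (Y ω : ℂ) * Complex.exp (Complex.I * (r * F ω : ℝ))) P := by
  refine Integrable.mono' hY.norm
    (hY.ofReal.aestronglyMeasurable.mul (aestronglyMeasurable_exp_I_mul hF r))
    (ae_of_all _ fun ω => ?_)
  rw [norm_mul, Complex.norm_exp_I_mul_ofReal, mul_one, Complex.norm_real]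

/-- The characteristic functionals of `L¹`-close random variables are close. -/
lemma norm_integral_mul_exp_sub_le [IsFiniteMeasure P] {Y F G : Ω → ℝ} {C : ℝ}
    (hY : AEMeasurable Y P) (hC : ∀ ω, |Y ω| ≤ C) (hF : AEMeasurable F P) (hG : AEMeasurable G P)
    (hFG : Integrable (fun ω => F ω - G ω) P) (r : ℝ) :
    ‖∫ ω, (Y ω : ℂ) * Complex.exp (Complex.I * (r * F ω : ℝ)) ∂P -
      ∫ ω, (Y ω : ℂ) * Complex.exp (Complex.I * (r * G ω : ℝ)) ∂P‖ ≤
      C * |r| * ∫ ω, |F ω - G ω| ∂P := by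
  have hYi : Integrable Y P :=
    Integrable.of_bound hY.aestronglyMeasurable C (ae_of_all _ hC)
  rw [← integral_sub (integrable_mul_exp_I_mul hYi hF r) (integrable_mul_exp_I_mul hYi hG r),
    ← integral_const_mul]
  refine norm_integral_le_of_norm_le (hFG.abs.const_mul _) (ae_of_all _ fun ω => ?_)
  rw [← mul_sub, norm_mul, Complex.norm_real, Real.norm_eq_abs, mul_assoc, ← abs_mul, mul_sub]
  exact mul_le_mul (hC ω) (norm_exp_I_mul_sub_le _ _) (norm_nonneg _) ((abs_nonneg _).trans (hC ω))

lemma integral_abs_le_eLpNorm_two [IsProbabilityMeasure P] {f : Ω → ℝ} (hf : MemLp f 2 P) :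
    ∫ ω, |f ω| ∂P ≤ (eLpNorm f 2 P).toReal := by
  have h1 : ∫ ω, |f ω| ∂P = (eLpNorm f 1 P).toReal := by
    rw [eLpNorm_one_eq_lintegral_enorm, ← integral_norm_eq_lintegral_enorm hf.1]
    rfl
  rw [h1]
  exact ENNReal.toReal_mono hf.2.ne
    (eLpNorm_le_eLpNorm_of_exponent_le (by norm_num) hf.1)

lemma tendsto_integral_mul_exp [IsProbabilityMeasure P] {Y G : Ω → ℝ} {F : ℕ → Ω → ℝ} {C : ℝ}
    (hY : AEMeasurable Y P) (hC : ∀ ω, |Y ω| ≤ C) (hF : ∀ k, MemLp (F k) 2 P) (hG : MemLp G 2 P)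
    (hlim : Tendsto (fun k => eLpNorm (fun ω => F k ω - G ω) 2 P) atTop (𝓝 0)) (r : ℝ) :
    Tendsto (fun k => ∫ ω, (Y ω : ℂ) * Complex.exp (Complex.I * (r * F k ω : ℝ)) ∂P) atTop
      (𝓝 (∫ ω, (Y ω : ℂ) * Complex.exp (Complex.I * (r * G ω : ℝ)) ∂P)) := by
  rw [tendsto_iff_norm_sub_tendsto_zero]
  have h := ((ENNReal.tendsto_toReal ENNReal.zero_ne_top).comp hlim).const_mul (C * |r|)
  rw [ENNReal.toReal_zero, mul_zero] at h
  refine squeeze_zero (fun _ => norm_nonneg _) (fun k => ?_) h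
  have hC0 : 0 ≤ C * |r| := by
    have : Nonempty Ω := by
      by_contra hne
      rw [not_nonempty_iff] at hne
      exact IsProbabilityMeasure.ne_zero P (Measure.eq_zero_of_isEmpty P)
    exact mul_nonneg ((abs_nonneg _).trans (hC this.some)) (abs_nonneg _)
  exact (norm_integral_mul_exp_sub_le hY hC (hF k).1.aemeasurable hG.1.aemeasurable
    (((hF k).sub hG).integrable (by norm_num)) r).trans
    (mul_le_mul_of_nonneg_left (integral_abs_le_eLpNorm_two ((hF k).sub hG)) hC0)

lemma tendsto_integral_sq {α : Type*} {m : MeasurableSpace α} {μ : Measure α} {f : ℕ → α → ℝ}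
    {g : α → ℝ} (hf : ∀ k, MemLp (f k) 2 μ) (hg : MemLp g 2 μ)
    (h : Tendsto (fun k => eLpNorm (fun x => f k x - g x) 2 μ) atTop (𝓝 0)) :
    Tendsto (fun k => ∫ x, f k x ^ 2 ∂μ) atTop (𝓝 (∫ x, g x ^ 2 ∂μ)) := by
  have key {f : α → ℝ} (hf : MemLp f 2 μ) : ‖hf.toLp f‖ ^ 2 = ∫ x, f x ^ 2 ∂μ := by
    rw [Lp.norm_toLp, ← ENNReal.toReal_pow, eLpNorm_two_sq_eq_ofReal hf,
      ENNReal.toReal_ofReal (integral_nonneg fun _ => sq_nonneg _)]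
  simp_rw [← key hg, ← fun k => key (hf k)]
  refine Tendsto.pow (Tendsto.norm ?_) 2
  rw [tendsto_iff_edist_tendsto_0]
  simp_rw [Lp.edist_toLp_toLp]
  exact h

lemma integral_exp_of_hasGaussianLaw {X : Ω → ℝ} (hX : HasGaussianLaw X P)
    (h0 : ∫ ω, X ω ∂P = 0) (r : ℝ) :
    ∫ ω, Complex.exp (Complex.I * (r * X ω : ℝ)) ∂P =
      Complex.exp ((-(r ^ 2 * ∫ ω, X ω ^ 2 ∂P) / 2 : ℝ)) := by
  have : IsProbabilityMeasure P := hX.isProbabilityMeasure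
  have h := charFun_gaussianReal (μ := P[X]) (v := (Var[X; P]).toNNReal) r
  rw [← hX.map_eq_gaussianReal, charFun_apply_real,
    integral_map hX.aemeasurable (by fun_prop), h0,
    Real.coe_toNNReal _ (variance_nonneg _ _), variance_of_integral_eq_zero hX.aemeasurable h0] at h
  rw [show (∫ ω, Complex.exp (Complex.I * (r * X ω : ℝ)) ∂P) =
    ∫ ω, Complex.exp (r * X ω * Complex.I) ∂P by
      congr 1; ext ω; push_cast; ring_nf, h]
  push_cast
  ring_nf

end CharacteristicFunction

/-! ### Independence of the increments inside and outside of `[δ, 1]` -/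

section Gap

variable {Ω : Type u} [mΩ : MeasurableSpace Ω] {P : Measure Ω} {B : ℝ≥0 → Ω → ℝ}

/-- The path of `B` up to time `δ`, together with the increments of `B` after time `1`: all the
information on `B` outside of the time interval `[δ, 1]`. -/
def outsideProcess (B : ℝ≥0 → Ω → ℝ) (δ : ℝ≥0) : Set.Iic δ ⊕ ℝ≥0 → Ω → ℝ :=
  Sum.elim (fun s => B s) (fun s ω => B (1 + s) ω - B 1 ω)

/-- The σ-field generated by `B` up to time `δ` and by the increments of `B` after time `1`. -/
@[reducible] def outsideSigma (B : ℝ≥0 → Ω → ℝ) (δ : ℝ≥0) : MeasurableSpace Ω :=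
  MeasurableSpace.comap (fun ω i => outsideProcess B δ i ω) MeasurableSpace.pi

lemma covariance_increment (hB : IsPreBrownianReal B P) (s a b : ℝ≥0) :
    cov[B s, fun ω => B b ω - B a ω; P] = min (s : ℝ) b - min (s : ℝ) a := by
  have := hB.isGaussianProcess.isProbabilityMeasure
  rw [covariance_fun_sub_right, hB.covariance_fun_eval, hB.covariance_fun_eval]
  · push_cast; rfl
  all_goals exact (hB.isGaussianProcess.hasGaussianLaw_eval _).memLp_two

/-- The increments of `B` within `[δ, 1]` are independent of what happens outside of `[δ, 1]`. -/
lemma indepFun_outside (hB : IsPreBrownianReal B P) (δ : ℝ≥0) :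
    IndepFun (fun ω i => outsideProcess B δ i ω)
      (fun ω (t : Set.Icc δ 1) => B t ω - B δ ω) P := by
  have := hB.isGaussianProcess.isProbabilityMeasure
  have hm (t : ℝ≥0) : AEMeasurable (B t) P := hB.aemeasurable t
  refine IsGaussianProcess.indepFun_of_covariance_eq_zero
    (X := outsideProcess B δ) (Y := fun (t : Set.Icc δ 1) ω => B t ω - B δ ω) ?_ ?_ ?_ ?_
  · classical
    have key (a b : ℝ≥0) : ∃ J : Finset ℝ≥0, ∃ L : (J → ℝ) →L[ℝ] ℝ, ∀ ω,
        B a ω - B b ω = L (J.restrict (B · ω)) :=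
      ⟨{a, b}, { toFun x := x ⟨a, by simp⟩ - x ⟨b, by simp⟩
                 map_add' x y := by simp; ring
                 map_smul' c x := by simp; ring }, by simp⟩
    apply hB.isGaussianProcess.of_isGaussianProcess
    rintro ((⟨t, ht⟩ | t) | t)
    · exact ⟨{t}, { toFun x := x ⟨t, by simp⟩
                    map_add' x y := by simp
                    map_smul' c x := by simp }, by simp [outsideProcess]⟩
    · exact key (1 + t) 1
    · exact key t δ
  · rintro (t | t)
    · exact hm t
    · exact (hm _).sub (hm _)
  · exact fun t => (hm _).sub (hm _)
  · rintro (⟨s, hs⟩ | s) ⟨t, ht1, ht2⟩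
    · have h1 : (s : ℝ) ≤ δ := hs
      have h2 : (δ : ℝ) ≤ t := ht1
      simp only [outsideProcess, Sum.elim_inl]
      rw [covariance_increment hB, min_eq_left h1, min_eq_left (h1.trans h2), sub_self]
    · have h2 : (δ : ℝ) ≤ t := ht1
      have h3 : (t : ℝ) ≤ 1 := ht2
      simp only [outsideProcess, Sum.elim_inr]
      rw [covariance_fun_sub_left (hB.isGaussianProcess.hasGaussianLaw_eval _).memLp_two
        (hB.isGaussianProcess.hasGaussianLaw_eval _).memLp_two (hB.memLp_sub _ _)]
      rw [covariance_increment hB, covariance_increment hB]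
      have h4 : (1 : ℝ) ≤ ((1 + s : ℝ≥0) : ℝ) := by push_cast; linarith [s.2]
      rw [min_eq_right (h3.trans h4), min_eq_right ((h2.trans h3).trans h4),
        NNReal.coe_one, min_eq_right h3, min_eq_right (h2.trans h3)]
      ring

end Gap

/-! ### The law of Wiener integrals -/

section WienerCharacteristicFunction

variable {Ω : Type u} [mΩ : MeasurableSpace Ω] {P : Measure Ω} [P.IsComplete] {B : ℝ≥0 → Ω → ℝ}
  {hBm : ∀ t, Measurable (B t)}

lemma SimpleItoProcess.hasGaussianLaw_integral (hB : IsPreBrownianReal B P)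
    (V : SimpleItoProcess (brownianFiltration P B hBm)) (hV : ∀ i, ∃ c : ℝ, ∀ ω, V.ξ i ω = c) :
    HasGaussianLaw (V.integral B) P := by
  choose c hc using hV
  have hG : IsGaussianProcess (fun (i : Fin V.size) ω =>
      c i * (B (unitInterval.toNNReal (V.b i)) ω - B (unitInterval.toNNReal (V.a i)) ω)) P := by
    classical
    apply hB.isGaussianProcess.of_isGaussianProcess
    intro i
    exact ⟨{unitInterval.toNNReal (V.b i), unitInterval.toNNReal (V.a i)},
      { toFun x := c i * (x ⟨unitInterval.toNNReal (V.b i), by simp⟩ -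
          x ⟨unitInterval.toNNReal (V.a i), by simp⟩)
        map_add' x y := by simp; ring
        map_smul' c x := by simp; ring }, by simp⟩
  have e : V.integral B = fun ω => ∑ i, c i *
      (B (unitInterval.toNNReal (V.b i)) ω - B (unitInterval.toNNReal (V.a i)) ω) := by
    ext ω
    simp only [SimpleItoProcess.integral, hc]
  rw [e]
  exact hG.hasGaussianLaw_fun_sum

lemma SimpleItoProcess.integral_integral_eq_zero (hB : IsPreBrownianReal B P)
    (V : SimpleItoProcess (brownianFiltration P B hBm)) (hV : ∀ i, ∃ c : ℝ, ∀ ω, V.ξ i ω = c) :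
    ∫ ω, V.integral B ω ∂P = 0 := by
  choose c hc using hV
  simp only [SimpleItoProcess.integral, hc]
  have hint (a b : ℝ≥0) (c : ℝ) : Integrable (fun ω => c * (B a ω - B b ω)) P :=
    ((hB.integrable_eval a).sub (hB.integrable_eval b)).const_mul c
  rw [integral_finsetSum _ fun i _ => hint _ _ _]
  refine Finset.sum_eq_zero fun i _ => ?_
  rw [integral_const_mul, hB.integral_sub_eq_zero, mul_zero]

/-- The elementary integral over `(δ, 1]` of a deterministic simple process is a centered normal
variable, independent of `B` outside of `[δ, 1]`. -/
lemma SimpleItoProcess.setIntegral_exp (hB : IsPreBrownianReal B P)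
    (V : SimpleItoProcess (brownianFiltration P B hBm)) (hV : ∀ i, ∃ c : ℝ, ∀ ω, V.ξ i ω = c)
    {δ : I} (hδ : ∀ i, δ ≤ V.a i) {A : Set Ω}
    (hA : MeasurableSet[outsideSigma B (unitInterval.toNNReal δ)] A) (r : ℝ) :
    ∫ ω in A, Complex.exp (Complex.I * (r * V.integral B ω : ℝ)) ∂P =
      P.real A * Complex.exp ((-(r ^ 2 * ∫ ω, V.integral B ω ^ 2 ∂P) / 2 : ℝ)) := by
  have := hB.isGaussianProcess.isProbabilityMeasure
  set d := unitInterval.toNNReal δ with hd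
  have hmeas : Measurable[MeasurableSpace.comap (fun ω (t : Set.Icc d 1) => B t ω - B d ω)
      MeasurableSpace.pi] (V.integral B) := by
    choose c hc using hV
    have h (t : I) (ht : δ ≤ t) :
        Measurable[MeasurableSpace.comap (fun ω (t : Set.Icc d 1) => B t ω - B d ω)
          MeasurableSpace.pi] (fun ω => B (unitInterval.toNNReal t) ω - B d ω) :=
      (measurable_pi_apply (X := fun _ : Set.Icc d 1 => ℝ)
        ⟨unitInterval.toNNReal t, ht, t.2.2⟩).comp
        (comap_measurable (fun ω (t : Set.Icc d 1) => B t ω - B d ω))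
    have e : V.integral B = fun ω => ∑ i, c i *
        ((B (unitInterval.toNNReal (V.b i)) ω - B d ω) -
          (B (unitInterval.toNNReal (V.a i)) ω - B d ω)) := by
      ext ω
      simp only [SimpleItoProcess.integral, hc, sub_sub_sub_cancel_right]
    rw [e]
    exact Finset.measurable_sum _ fun i _ =>
      ((h _ ((hδ i).trans (V.le i))).sub (h _ (hδ i))).const_mul (c i)
  have hind : Indep (outsideSigma B d) (MeasurableSpace.comap (V.integral B) inferInstance) P :=
    indep_of_indep_of_le_right ((IndepFun_iff_Indep _ _ _).1 (indepFun_outside hB d))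
      hmeas.comap_le
  have hle : outsideSigma B d ≤ mΩ := by
    refine Measurable.comap_le (measurable_pi_lambda _ ?_)
    rintro (t | t)
    · exact hBm t
    · exact (hBm _).sub (hBm _)
  have hI := V.hasGaussianLaw_integral hB hV
  rw [hind.setIntegral_eq_smul hle (f := fun x : ℝ => Complex.exp (Complex.I * (r * x : ℝ)))
    hI.aemeasurable hA (by fun_prop),
    integral_exp_of_hasGaussianLaw hI (V.integral_integral_eq_zero hB hV) r, Complex.real_smul]

/-- The Wiener integral over `(δ, 1]` of a deterministic function `ψ` is a centered normal variable
with variance `∫ ψ²`, independent of `B` outside of `[δ, 1]`. -/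
lemma setIntegral_exp_wienerIntegral (hB : IsPreBrownianReal B P) {ψ : I → ℝ} (hψ : Measurable ψ)
    {C : ℝ} (hC : ∀ t, |ψ t| ≤ C) {G : Ω → ℝ} (hG : MemLp G 2 P)
    {V : ℕ → SimpleItoProcess (brownianFiltration P B hBm)} {δ : I}
    (hδ : ∀ k i, δ ≤ (V k).a i) (hdet : ∀ k i, ∃ c : ℝ, ∀ ω, (V k).ξ i ω = c)
    (hV : Tendsto (fun k => processDist P (V k).eval (fun t _ => ψ t)) atTop (𝓝 0))
    (hVG : Tendsto (fun k => eLpNorm (fun ω => (V k).integral B ω - G ω) 2 P) atTop (𝓝 0))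
    {A : Set Ω} (hA : MeasurableSet[outsideSigma B (unitInterval.toNNReal δ)] A)
    (hA' : MeasurableSet A) (r : ℝ) :
    ∫ ω in A, Complex.exp (Complex.I * (r * G ω : ℝ)) ∂P =
      P.real A * Complex.exp ((-(r ^ 2 * ∫ t, ψ t ^ 2) / 2 : ℝ)) := by
  have := hB.isGaussianProcess.isProbabilityMeasure
  have hind (F : Ω → ℝ) : ∫ ω in A, Complex.exp (Complex.I * (r * F ω : ℝ)) ∂P =
      ∫ ω, ((A.indicator (fun _ => (1 : ℝ)) ω : ℝ) : ℂ) * Complex.exp (Complex.I * (r * F ω : ℝ)) ∂P := by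
    rw [← integral_indicator hA']
    congr 1
    ext ω
    by_cases h : ω ∈ A <;> simp [h]
  have h1 : Tendsto (fun k => ∫ ω in A, Complex.exp (Complex.I * (r * (V k).integral B ω : ℝ)) ∂P)
      atTop (𝓝 (∫ ω in A, Complex.exp (Complex.I * (r * G ω : ℝ)) ∂P)) := by
    simp_rw [hind]
    refine tendsto_integral_mul_exp (C := 1) ((measurable_const.indicator hA').aemeasurable)
      (fun ω => ?_) (fun k => (V k).memLp_integral hB) hG hVG r
    by_cases h : ω ∈ A <;> simp [h]
  have hψ2 : MemLp (fun p : I × Ω => ψ p.1) 2 ((volume : Measure I).prod P) :=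
    MemLp.of_bound (hψ.comp measurable_fst).aestronglyMeasurable C (ae_of_all _ fun p => hC p.1)
  have h2 := tendsto_integral_sq (fun k => (V k).memLp_eval (P := P)) hψ2 hV
  rw [integral_fun_fst (fun t => ψ t ^ 2), probReal_univ, one_smul] at h2
  have h3 (k : ℕ) : ∫ p : I × Ω, (V k).eval p.1 p.2 ^ 2 ∂((volume : Measure I).prod P) =
      ∫ ω, (V k).integral B ω ^ 2 ∂P := by
    simp_rw [pow_two]
    exact ((V k).integral_mul_integral hB (V k)).symm
  simp_rw [h3] at h2
  refine tendsto_nhds_unique h1 ?_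
  simp_rw [fun k => (V k).setIntegral_exp hB (hdet k) (hδ k) hA r]
  have hcont : Continuous (fun x : ℝ => (P.real A : ℂ) *
      Complex.exp ((-(r ^ 2 * x) / 2 : ℝ))) := by fun_prop
  exact (hcont.tendsto _).comp h2

end WienerCharacteristicFunction

/-! ### From mixing to stable convergence -/

section Mixing

/-- Limits may be exchanged when the approximation error is asymptotically small. -/
lemma tendsto_of_forall_approx {E : Type*} [SeminormedAddCommGroup E] {x : ℕ → E} {a : E}
    (h : ∀ ε > 0, ∃ (y : ℕ → E) (b : E), Tendsto y atTop (𝓝 b) ∧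
      (∀ᶠ n in atTop, ‖x n - y n‖ ≤ ε) ∧ ‖b - a‖ ≤ ε) : Tendsto x atTop (𝓝 a) := by
  rw [Metric.tendsto_nhds]
  intro ε hε
  obtain ⟨y, b, hy, hxy, hb⟩ := h (ε / 4) (by positivity)
  filter_upwards [(Metric.tendsto_nhds.1 hy) (ε / 4) (by positivity), hxy] with n h1 h2
  calc dist (x n) a ≤ dist (x n) (y n) + dist (y n) b + dist b a := dist_triangle4 _ _ _ _
    _ < ε / 4 + ε / 4 + ε / 2 := by
      rw [dist_eq_norm (x n), dist_eq_norm b]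
      linarith
    _ = ε := by ring

lemma integral_eq_sum_of_finite_range {α : Type*} {m : MeasurableSpace α} {μ : Measure α}
    {v : α → ℝ} (hv : Measurable v) (hfin : (Set.range v).Finite) {K : ℝ → α → ℂ}
    (hK : ∀ c, Integrable (K c) μ) :
    ∫ x, K (v x) x ∂μ = ∑ c ∈ hfin.toFinset, ∫ x in v ⁻¹' {c}, K c x ∂μ := by
  have hs (c : ℝ) : MeasurableSet (v ⁻¹' {c}) := hv (measurableSet_singleton c)
  simp_rw [← fun c => integral_indicator (f := K c) (μ := μ) (hs c)]
  rw [← integral_finsetSum _ fun c _ => (hK c).indicator (hs c)]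
  congr 1
  ext x
  rw [Finset.sum_eq_single (v x)]
  · simp
  · intro c _ hc
    exact Set.indicator_of_notMem (fun h => hc h.symm) _
  · intro h
    simp at h

variable {Ω : Type u} {Ω' : Type v} {m m₀ : MeasurableSpace Ω} {P : Measure Ω}
  [mΩ' : MeasurableSpace Ω'] {P' : Measure Ω'} {π : Ω' → Ω}

lemma MeasureTheory.MeasurePreserving.isProbabilityMeasure [IsProbabilityMeasure P']
    (hπ : MeasurePreserving π P' P) : IsProbabilityMeasure P := by
  rw [← hπ.map_eq]
  exact Measure.isProbabilityMeasure_map hπ.measurable.aemeasurable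

/-- Mixing on sets implies mixing on functions with finitely many values. -/
lemma tendsto_integral_mul_of_finite_range (hm : m ≤ m₀) [IsProbabilityMeasure P']
    (hπ : MeasurePreserving π P' P)
    {f : ℕ → Ω' → ℂ} (hf : ∀ n, AEStronglyMeasurable (f n) P') (hf1 : ∀ n ω, ‖f n ω‖ ≤ 1) {c : ℂ}
    (h : ∀ A, MeasurableSet[m] A →
      Tendsto (fun n => ∫ ω' in π ⁻¹' A, f n ω' ∂P') atTop (𝓝 (P.real A * c)))
    {Y : Ω → ℝ} (hY : Measurable[m] Y) (hfin : (Set.range Y).Finite) :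
    Tendsto (fun n => ∫ ω', (Y (π ω') : ℂ) * f n ω' ∂P') atTop (𝓝 ((∫ ω, Y ω ∂P : ℝ) * c)) := by
  have hP : IsProbabilityMeasure P := hπ.isProbabilityMeasure
  have hY₀ : Measurable Y := hY.mono hm le_rfl
  have hfi (n : ℕ) : Integrable (f n) P' := Integrable.of_bound (hf n) 1 (ae_of_all _ (hf1 n))
  have hfin' : (Set.range (fun ω' => Y (π ω'))).Finite :=
    hfin.subset (Set.range_comp_subset_range π Y)
  have e (n : ℕ) : ∫ ω', (Y (π ω') : ℂ) * f n ω' ∂P' =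
      ∑ y ∈ hfin.toFinset, (y : ℂ) * ∫ ω' in π ⁻¹' (Y ⁻¹' {y}), f n ω' ∂P' := by
    rw [integral_eq_sum_of_finite_range (v := fun ω' => Y (π ω')) (hY₀.comp hπ.measurable) hfin'
      (K := fun y ω' => (y : ℂ) * f n ω') (fun y => (hfi n).const_mul _)]
    simp_rw [integral_const_mul]
    refine Finset.sum_subset (fun y hy => ?_) (fun y _ hy => ?_)
    · rw [Set.Finite.mem_toFinset] at hy ⊢
      exact Set.range_comp_subset_range π Y hy
    · have : (fun ω' => Y (π ω')) ⁻¹' {y} = ∅ := by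
        rw [Set.Finite.mem_toFinset] at hy
        exact Set.preimage_singleton_eq_empty.2 hy
      rw [this]
      simp
  have e' : ((∫ ω, Y ω ∂P : ℝ) : ℂ) = ∑ y ∈ hfin.toFinset, (y : ℂ) * P.real (Y ⁻¹' {y}) := by
    have := integral_eq_sum_of_finite_range (μ := P) hY₀ hfin (K := fun y _ => (y : ℂ))
      (fun y => integrable_const _)
    rw [← integral_complex_ofReal, this]
    refine Finset.sum_congr rfl fun y _ => ?_
    rw [setIntegral_const, Complex.real_smul, mul_comm]
  simp_rw [e]
  rw [e', Finset.sum_mul]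
  refine tendsto_finsetSum _ fun y _ => ?_
  rw [mul_assoc]
  exact (h _ (hY (measurableSet_singleton y))).const_mul _

/-- Mixing on sets implies mixing on bounded functions. -/
lemma tendsto_integral_mul_of_bounded (hm : m ≤ m₀) [IsProbabilityMeasure P']
    (hπ : MeasurePreserving π P' P)
    {f : ℕ → Ω' → ℂ} (hf : ∀ n, AEStronglyMeasurable (f n) P') (hf1 : ∀ n ω, ‖f n ω‖ ≤ 1) {c : ℂ}
    (h : ∀ A, MeasurableSet[m] A →
      Tendsto (fun n => ∫ ω' in π ⁻¹' A, f n ω' ∂P') atTop (𝓝 (P.real A * c)))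
    {Y : Ω → ℝ} (hY : Measurable[m] Y) {C : ℝ} (hC : ∀ ω, |Y ω| ≤ C) :
    Tendsto (fun n => ∫ ω', (Y (π ω') : ℂ) * f n ω' ∂P') atTop (𝓝 ((∫ ω, Y ω ∂P : ℝ) * c)) := by
  have hP : IsProbabilityMeasure P := hπ.isProbabilityMeasure
  refine tendsto_of_forall_approx fun ε hε => ?_
  -- round `Y` down to multiples of `η`
  set η : ℝ := ε / (1 + ‖c‖) with hη
  have hη0 : 0 < η := by positivity
  let S : Ω → ℝ := fun ω => ⌊Y ω / η⌋ * η
  have hSm : Measurable[m] S :=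
    ((measurable_from_top (f := fun k : ℤ => (k : ℝ))).comp
      (Int.measurable_floor.comp (hY.div_const η))).mul_const η
  have hYS (ω : Ω) : |Y ω - S ω| ≤ η := by
    have h1 := Int.floor_le (Y ω / η)
    have h2 := Int.lt_floor_add_one (Y ω / η)
    rw [le_div_iff₀ hη0] at h1
    rw [div_lt_iff₀ hη0] at h2
    rw [abs_le]
    constructor <;> simp only [S] <;> linarith
  have hSfin : (Set.range S).Finite := by
    refine ((Set.finite_Icc ⌊-C / η⌋ ⌊C / η⌋).image (fun k : ℤ => (k : ℝ) * η)).subset ?_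
    rintro _ ⟨ω, rfl⟩
    refine ⟨⌊Y ω / η⌋, ⟨?_, ?_⟩, rfl⟩
    · exact Int.floor_le_floor (by gcongr; exact (abs_le.1 (hC ω)).1)
    · exact Int.floor_le_floor (by gcongr; exact (abs_le.1 (hC ω)).2)
  have hY₀ : Measurable Y := hY.mono hm le_rfl
  have hS₀ : Measurable S := hSm.mono hm le_rfl
  have hfi (n : ℕ) : Integrable (f n) P' := Integrable.of_bound (hf n) 1 (ae_of_all _ (hf1 n))
  have hYi : Integrable Y P := Integrable.of_bound hY₀.aestronglyMeasurable C (ae_of_all _ hC)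
  have hYSi : Integrable (fun ω => Y ω - S ω) P :=
    Integrable.of_bound (hY₀.sub hS₀).aestronglyMeasurable η (ae_of_all _ hYS)
  have hSi : Integrable S P := by
    have := hYi.sub hYSi
    refine this.congr (ae_of_all _ fun ω => ?_)
    simp
  have hmul {Z : Ω → ℝ} (hZ : Integrable Z P) (n : ℕ) :
      Integrable (fun ω' => (Z (π ω') : ℂ) * f n ω') P' :=
    (((hπ.integrable_comp hZ.1).2 hZ).ofReal).mul_bdd (hf n) (ae_of_all _ (hf1 n))
  refine ⟨_, _, tendsto_integral_mul_of_finite_range hm hπ hf hf1 h hSm hSfin,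
    .of_forall fun n => ?_, ?_⟩
  · rw [← integral_sub (hmul hYi n) (hmul hSi n)]
    refine (norm_integral_le_of_norm_le_const (C := η) (ae_of_all _ fun ω' => ?_)).trans ?_
    · rw [← sub_mul, norm_mul, ← Complex.ofReal_sub, Complex.norm_real]
      exact (mul_le_of_le_one_right (norm_nonneg _) (hf1 n ω')).trans (hYS _)
    · rw [probReal_univ, mul_one, hη]
      exact div_le_self hε.le (by linarith [norm_nonneg c])
  · rw [← sub_mul, ← Complex.ofReal_sub, ← integral_sub hSi hYi, norm_mul, Complex.norm_real]
    have h1 : ‖∫ ω, S ω - Y ω ∂P‖ ≤ η := by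
      refine (norm_integral_le_of_norm_le_const (C := η) (ae_of_all _ fun ω => ?_)).trans ?_
      · rw [Real.norm_eq_abs, abs_sub_comm]
        exact hYS ω
      · rw [probReal_univ, mul_one]
    calc _ ≤ η * ‖c‖ := mul_le_mul_of_nonneg_right h1 (norm_nonneg _)
      _ ≤ η * (1 + ‖c‖) := by gcongr; linarith
      _ = ε := by rw [hη]; field_simp

/-- If the `W n` are asymptotically normal with variance `L` and asymptotically independent of `m`,
then `v * W n` converges stably, for every `m`-measurable `v` with finitely many values. The limit
of the characteristic functionals does not depend on the extension of `P` on which the `W n` are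
defined. -/
lemma tendsto_integral_mul_exp_of_mixing (hm : m ≤ m₀) [IsProbabilityMeasure P']
    (hπ : MeasurePreserving π P' P) {W : ℕ → Ω' → ℝ} (hW : ∀ n, AEMeasurable (W n) P') {L : ℝ}
    (h : ∀ r : ℝ, ∀ A, MeasurableSet[m] A →
      Tendsto (fun n => ∫ ω' in π ⁻¹' A, Complex.exp (Complex.I * (r * W n ω' : ℝ)) ∂P') atTop
        (𝓝 (P.real A * Complex.exp ((-(r ^ 2 * L) / 2 : ℝ)))))
    {Y : Ω → ℝ} (hY : Measurable[m] Y) {C : ℝ} (hC : ∀ ω, |Y ω| ≤ C)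
    {v : Ω → ℝ} (hv : Measurable[m] v) (hfin : (Set.range v).Finite) (r : ℝ) :
    Tendsto (fun n => ∫ ω', (Y (π ω') : ℂ) *
      Complex.exp (Complex.I * (r * (v (π ω') * W n ω') : ℝ)) ∂P') atTop
      (𝓝 (∑ c ∈ hfin.toFinset, ((∫ ω in v ⁻¹' {c}, Y ω ∂P : ℝ) : ℂ) *
        Complex.exp ((-((r * c) ^ 2 * L) / 2 : ℝ)))) := by
  have hP : IsProbabilityMeasure P := hπ.isProbabilityMeasure
  have hY₀ : Measurable Y := hY.mono hm le_rfl
  have hv₀ : Measurable v := hv.mono hm le_rfl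
  have hYi : Integrable Y P := Integrable.of_bound hY₀.aestronglyMeasurable C (ae_of_all _ hC)
  have hfin' : (Set.range (fun ω' => v (π ω'))).Finite :=
    hfin.subset (Set.range_comp_subset_range π v)
  have e (n : ℕ) : ∫ ω', (Y (π ω') : ℂ) *
      Complex.exp (Complex.I * (r * (v (π ω') * W n ω') : ℝ)) ∂P' =
      ∑ c ∈ hfin.toFinset, ∫ ω', (((v ⁻¹' {c}).indicator Y (π ω') : ℝ) : ℂ) *
        Complex.exp (Complex.I * ((r * c) * W n ω' : ℝ)) ∂P' := by
    rw [integral_eq_sum_of_finite_range (v := fun ω' => v (π ω')) (hv₀.comp hπ.measurable) hfin'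
      (K := fun c ω' => (Y (π ω') : ℂ) * Complex.exp (Complex.I * (r * (c * W n ω') : ℝ)))
      (fun c => integrable_mul_exp_I_mul ((hπ.integrable_comp hYi.1).2 hYi)
        ((hW n).const_mul c) r)]
    refine (Finset.sum_subset (fun c hc => ?_) (fun c _ hc => ?_)).trans
      (Finset.sum_congr rfl fun c _ => ?_)
    · rw [Set.Finite.mem_toFinset] at hc ⊢
      exact Set.range_comp_subset_range π v hc
    · have : (fun ω' => v (π ω')) ⁻¹' {c} = ∅ := by
        rw [Set.Finite.mem_toFinset] at hc
        exact Set.preimage_singleton_eq_empty.2 hc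
      rw [this]
      simp
    · have hs : MeasurableSet ((fun ω' => v (π ω')) ⁻¹' {c}) :=
        (hv₀.comp hπ.measurable) (measurableSet_singleton c)
      rw [← integral_indicator hs]
      congr 1
      ext ω'
      by_cases hc : v (π ω') = c <;> simp [Set.indicator, hc, mul_assoc]
  simp_rw [e]
  refine tendsto_finsetSum _ fun c _ => ?_
  rw [← integral_indicator (hv₀ (measurableSet_singleton c))]
  refine tendsto_integral_mul_of_bounded hm hπ
    (fun n => aestronglyMeasurable_exp_I_mul (hW n) (r * c))
    (fun n ω' => (Complex.norm_exp_I_mul_ofReal _).le) (h (r * c))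
    (hY.indicator (hv (measurableSet_singleton c))) (C := C) (fun ω => ?_)
  exact (norm_indicator_le_norm_self Y ω).trans (hC ω)

end Mixing

/-! ### Mixing with respect to the Brownian σ-field -/

section BrownianMixing

variable {Ω : Type u} {B : ℝ≥0 → Ω → ℝ}

lemma outsideSigma_eq_iSup (B : ℝ≥0 → Ω → ℝ) (δ : ℝ≥0) :
    outsideSigma B δ = ⨆ i, MeasurableSpace.comap (outsideProcess B δ i) inferInstance :=
  comap_pi_eq_iSup _

lemma measurable_outsideSigma_left {s δ : ℝ≥0} (h : s ≤ δ) : Measurable[outsideSigma B δ] (B s) := by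
  rw [outsideSigma_eq_iSup]
  exact (comap_measurable (B s)).mono (le_iSup (fun i =>
    MeasurableSpace.comap (outsideProcess B δ i) inferInstance) (Sum.inl ⟨s, h⟩)) le_rfl

lemma measurable_outsideSigma_right (s δ : ℝ≥0) :
    Measurable[outsideSigma B δ] (fun ω => B (1 + s) ω - B 1 ω) := by
  rw [outsideSigma_eq_iSup]
  exact (comap_measurable (fun ω => B (1 + s) ω - B 1 ω)).mono (le_iSup (fun i =>
    MeasurableSpace.comap (outsideProcess B δ i) inferInstance) (Sum.inr s)) le_rfl

lemma outsideSigma_mono (B : ℝ≥0 → Ω → ℝ) : Monotone (outsideSigma B) := by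
  intro δ δ' h
  rw [outsideSigma_eq_iSup B δ]
  refine iSup_le ?_
  rintro (⟨s, hs⟩ | s)
  · exact (measurable_outsideSigma_left (le_trans hs h)).comap_le
  · exact (measurable_outsideSigma_right s δ').comap_le

variable [mΩ : MeasurableSpace Ω] {P : Measure Ω}

/-- Mixing passes from an increasing sequence of σ-fields to the σ-field it generates. -/
lemma tendsto_setIntegral_iSup [IsProbabilityMeasure P] {H : ℕ → MeasurableSpace Ω}
    (hmono : Monotone H) (hle : ∀ k, H k ≤ mΩ)
    {f : ℕ → Ω → ℂ} (hf : ∀ n, AEStronglyMeasurable (f n) P) (hf1 : ∀ n ω, ‖f n ω‖ ≤ 1) {c : ℂ}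
    (h : ∀ k A, MeasurableSet[H k] A →
      Tendsto (fun n => ∫ ω in A, f n ω ∂P) atTop (𝓝 (P.real A * c)))
    {A : Set Ω} (hA : MeasurableSet[⨆ k, H k] A) :
    Tendsto (fun n => ∫ ω in A, f n ω ∂P) atTop (𝓝 (P.real A * c)) := by
  have hfi (n : ℕ) : Integrable (f n) P := Integrable.of_bound (hf n) 1 (ae_of_all _ (hf1 n))
  have hpi : IsPiSystem (⋃ k, {t | MeasurableSet[H k] t}) :=
    isPiSystem_iUnion_of_monotone _ (fun k => @MeasurableSpace.isPiSystem_measurableSet Ω (H k))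
      fun _ _ hkl => hmono hkl
  have hsup : (⨆ k, H k) ≤ mΩ := iSup_le hle
  induction A, hA using MeasurableSpace.induction_on_inter
    (MeasurableSpace.generateFrom_iUnion_measurableSet H).symm hpi with
  | empty => simp
  | basic A hA =>
    obtain ⟨k, hk⟩ := Set.mem_iUnion.1 hA
    exact h k A hk
  | compl A hA ih =>
    have huniv := h 0 Set.univ MeasurableSet.univ
    simp only [Measure.restrict_univ, probReal_univ, Complex.ofReal_one, one_mul] at huniv
    rw [probReal_compl_eq_one_sub (hsup _ hA)]
    push_cast
    rw [sub_mul, one_mul]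
    refine (huniv.sub ih).congr fun n => ?_
    rw [← integral_add_compl (hsup _ hA) (hfi n), add_sub_cancel_left]
  | iUnion A hd hA ih =>
    have hA' (i : ℕ) : MeasurableSet (A i) := hsup _ (hA i)
    have hsum : HasSum (fun i => P.real (A i)) (P.real (⋃ i, A i)) := by
      have h := ENNReal.hasSum_toReal (f := fun i => P (A i))
        (by rw [← measure_iUnion hd hA']; exact measure_ne_top _ _)
      rwa [← ENNReal.tsum_toReal_eq fun i => measure_ne_top _ _, ← measure_iUnion hd hA'] at h
    have e : (P.real (⋃ i, A i) : ℂ) * c = ∑' i, (P.real (A i) : ℂ) * c := by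
      rw [tsum_mul_right, ← Complex.ofReal_tsum, hsum.tsum_eq]
    rw [e]
    have e2 (n : ℕ) : ∫ ω in ⋃ i, A i, f n ω ∂P = ∑' i, ∫ ω in A i, f n ω ∂P :=
      integral_iUnion hA' hd (hfi n).integrableOn
    simp_rw [e2]
    refine tendsto_tsum_of_dominated_convergence hsum.summable ih (.of_forall fun n i => ?_)
    refine (norm_setIntegral_le_of_norm_le_const (C := 1) (measure_lt_top _ _)
      (fun ω _ => hf1 n ω)).trans ?_
    rw [one_mul]

lemma outsideSigma_le (hBm : ∀ t, Measurable (B t)) (δ : ℝ≥0) : outsideSigma B δ ≤ mΩ := by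
  refine Measurable.comap_le (measurable_pi_lambda _ ?_)
  rintro (t | t)
  · exact hBm t
  · exact (hBm _).sub (hBm _)

/-- Since `B` is continuous at time `1`, the information outside of `[δ, 1]` for all `δ < 1`
determines the whole of `B`, up to null sets. -/
lemma iSup_comap_le_eventually_outside (hB : IsBrownianReal B P) {d : ℕ → ℝ≥0}
    (hd1 : Tendsto d atTop (𝓝 1)) :
    (⨆ s : ℝ≥0, MeasurableSpace.comap (B s) inferInstance) ≤
      eventuallyMeasurableSpace (⨆ k, outsideSigma B (d k)) (ae P) := by
  set m := ⨆ k, outsideSigma B (d k) with hm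
  have hk (k : ℕ) : outsideSigma B (d k) ≤ m := le_iSup (fun k => outsideSigma B (d k)) k
  have h1 : Measurable[eventuallyMeasurableSpace m (ae P)] (B 1) := by
    have hlim : Measurable[m] (fun ω => limsup (fun k => B (d k) ω) atTop) :=
      Measurable.limsup fun k => (measurable_outsideSigma_left le_rfl).mono (hk k) le_rfl
    refine hlim.eventuallyMeasurable_of_eventuallyEq ?_
    filter_upwards [hB.cont] with ω hω
    exact ((hω.tendsto 1).comp hd1).limsup_eq.symm
  refine iSup_le fun s => Measurable.comap_le ?_
  rcases lt_or_ge s 1 with hs | hs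
  · obtain ⟨k, hk'⟩ := (hd1.eventually (lt_mem_nhds hs)).exists
    exact (measurable_outsideSigma_left hk'.le).mono ((hk k).trans le_eventuallyMeasurableSpace)
      le_rfl
  · have h2 : Measurable[eventuallyMeasurableSpace m (ae P)]
        (fun ω => B (1 + (s - 1)) ω - B 1 ω) :=
      (measurable_outsideSigma_right (s - 1) (d 0)).mono
        ((hk 0).trans le_eventuallyMeasurableSpace) le_rfl
    have := h1.add h2
    rw [add_tsub_cancel_of_le hs] at this
    convert this using 1
    ext ω
    simp

/-- Mixing with respect to the completed σ-field of `B` follows from mixing with respect to the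
σ-fields generated by `B` outside of `[δ, 1]`, for a sequence of `δ` that increases to `1`. -/
lemma tendsto_setIntegral_brownianSigma [IsProbabilityMeasure P] (hBm : ∀ t, Measurable (B t))
    (hB : IsBrownianReal B P) {d : ℕ → ℝ≥0} (hdm : Monotone d) (hd1 : Tendsto d atTop (𝓝 1))
    {f : ℕ → Ω → ℂ} (hf : ∀ n, AEStronglyMeasurable (f n) P) (hf1 : ∀ n ω, ‖f n ω‖ ≤ 1) {c : ℂ}
    (h : ∀ k A, MeasurableSet[outsideSigma B (d k)] A →
      Tendsto (fun n => ∫ ω in A, f n ω ∂P) atTop (𝓝 (P.real A * c)))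
    {A : Set Ω} (hA : MeasurableSet[brownianSigma P B] A) :
    Tendsto (fun n => ∫ ω in A, f n ω ∂P) atTop (𝓝 (P.real A * c)) := by
  obtain ⟨A', hA', hAA'⟩ := hA
  obtain ⟨A'', hA'', hAA''⟩ := iSup_comap_le_eventually_outside hB hd1 _ hA'
  have e := hAA'.trans hAA''
  simp_rw [setIntegral_congr_set e]
  rw [measureReal_congr e]
  exact tendsto_setIntegral_iSup (fun k l hkl => outsideSigma_mono B (hdm hkl))
    (fun k => outsideSigma_le hBm _) hf hf1 h hA''

end BrownianMixing

/-! ### Concentration of the kernels at time `1` -/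

section Kernels

variable {Ω : Type u} [mΩ : MeasurableSpace Ω] {P : Measure Ω} {B : ℝ≥0 → Ω → ℝ}
  {φ : ℕ → I → ℝ} {L : ℝ}

lemma le_iSup_kernel (hφb : ∀ n, ∃ C : ℝ, ∀ t, φ n t ≤ C) (n : ℕ) {δ t : I} (ht : t ≤ δ) :
    φ n t ≤ ⨆ t : Set.Icc 0 δ, φ n t := by
  obtain ⟨C, hC⟩ := hφb n
  exact le_ciSup (f := fun t : Set.Icc 0 δ => φ n t) ⟨C, by rintro _ ⟨t, rfl⟩; exact hC t⟩
    ⟨t, unitInterval.nonneg', ht⟩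

lemma exists_abs_le (hφ0 : ∀ n t, 0 ≤ φ n t) (hφb : ∀ n, ∃ C : ℝ, ∀ t, φ n t ≤ C) (n : ℕ) :
    ∃ C : ℝ, ∀ t, |φ n t| ≤ C := by
  obtain ⟨C, hC⟩ := hφb n
  exact ⟨C, fun t => by rw [abs_of_nonneg (hφ0 n t)]; exact hC t⟩

/-- The mass of `φ n ^ 2` concentrates near `1`, since `φ n` tends to `0` uniformly on `[0, δ]`. -/
lemma tendsto_integral_indicator_sq (hφm : ∀ n, Measurable (φ n)) (hφ0 : ∀ n t, 0 ≤ φ n t)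
    (hφb : ∀ n, ∃ C : ℝ, ∀ t, φ n t ≤ C)
    (h1 : Tendsto (fun n => ∫ t, φ n t ^ 2) atTop (𝓝 L)) {δ : I}
    (h2 : Tendsto (fun n => ⨆ t : Set.Icc 0 δ, φ n t) atTop (𝓝 0)) :
    Tendsto (fun n => ∫ t, (Set.Ioi δ).indicator (φ n) t ^ 2) atTop (𝓝 L) := by
  have hi (n : ℕ) : Integrable (fun t => φ n t ^ 2) := by
    obtain ⟨C, hC⟩ := exists_abs_le hφ0 hφb n
    refine Integrable.of_bound ((hφm n).pow_const 2).aestronglyMeasurable (C ^ 2)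
      (ae_of_all _ fun t => ?_)
    rw [norm_pow]
    exact pow_le_pow_left₀ (norm_nonneg _) (hC t) 2
  have e (n : ℕ) : ∫ t, (Set.Ioi δ).indicator (φ n) t ^ 2 =
      (∫ t, φ n t ^ 2) - ∫ t in Set.Iic δ, φ n t ^ 2 := by
    rw [← integral_add_compl (measurableSet_Iic (a := δ)) (hi n), add_sub_cancel_left,
      ← integral_indicator measurableSet_Iic.compl]
    congr 1
    ext t
    by_cases ht : δ < t
    · simp [ht]
    · simp [ht]
  simp_rw [e]
  have h3 : Tendsto (fun n => ∫ t in Set.Iic δ, φ n t ^ 2) atTop (𝓝 0) := by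
    have hs := h2.pow 2
    rw [zero_pow two_ne_zero] at hs
    refine squeeze_zero (fun n => integral_nonneg fun t => sq_nonneg _) (fun n => ?_) hs
    refine (Real.le_norm_self _).trans ((norm_setIntegral_le_of_norm_le_const
      (C := (⨆ t : Set.Icc 0 δ, φ n t) ^ 2) (measure_lt_top _ _) fun t ht => ?_).trans ?_)
    · rw [norm_pow, Real.norm_eq_abs, sq_abs]
      exact pow_le_pow_left₀ (hφ0 n t) (le_iSup_kernel hφb n ht) 2
    · exact mul_le_of_le_one_right (sq_nonneg _) measureReal_le_one
  simpa using h1.sub h3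

/-- Changing the lower limit of integration is asymptotically negligible. -/
lemma tendsto_processDist_indicator [IsProbabilityMeasure P] (hφ0 : ∀ n t, 0 ≤ φ n t)
    (hφb : ∀ n, ∃ C : ℝ, ∀ t, φ n t ≤ C) {δ δ' : I} (hδ : δ ≤ δ')
    (h2 : Tendsto (fun n => ⨆ t : Set.Icc 0 δ', φ n t) atTop (𝓝 0)) :
    Tendsto (fun n => processDist P (fun t _ => (Set.Ioi δ).indicator (φ n) t)
      (fun t _ => (Set.Ioi δ').indicator (φ n) t)) atTop (𝓝 0) := by
  have h3 := ENNReal.tendsto_ofReal h2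
  rw [ENNReal.ofReal_zero] at h3
  refine tendsto_of_tendsto_of_tendsto_of_le_of_le tendsto_const_nhds h3 (fun _ => zero_le)
    fun n => ?_
  refine (eLpNorm_le_of_ae_bound (C := ⨆ t : Set.Icc 0 δ', φ n t) (ae_of_all _ fun p => ?_)).trans
    ?_
  · have h0 : 0 ≤ ⨆ t : Set.Icc 0 δ', φ n t :=
      (hφ0 n 0).trans (le_iSup_kernel hφb n unitInterval.nonneg')
    by_cases ht : δ' < p.1
    · simp [ht, hδ.trans_lt ht, h0]
    · by_cases ht' : δ < p.1
      · simp only [Set.mem_Ioi, ht, ht', Set.indicator_of_mem, not_false_eq_true,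
          Set.indicator_of_notMem, sub_zero, Real.norm_eq_abs, abs_of_nonneg (hφ0 n _)]
        exact le_iSup_kernel hφb n (not_lt.1 ht)
      · simp [ht, ht', h0]
  · simp

end Kernels

/-! ### Extensions with an independent normal variable -/

section Extension

variable {Ω : Type u} [mΩ : MeasurableSpace Ω] {P : Measure Ω} {B : ℝ≥0 → Ω → ℝ}

lemma isIndepNormalOnExtension_prod [IsProbabilityMeasure P] (hBm : ∀ t, Measurable (B t)) :
    IsIndepNormalOnExtension P B (P.prod (gaussianReal 0 1)) Prod.fst Prod.snd where
  extension := measurePreserving_fst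
  law := measurePreserving_snd.hasLaw
  indep := by
    have h : IndepFun (fun p : Ω × ℝ => (fun ω (t : ℝ≥0) => B t ω) p.1) (fun p : Ω × ℝ => id p.2)
        (P.prod (gaussianReal 0 1)) :=
      indepFun_prod (measurable_pi_lambda _ hBm) measurable_id
    exact h.symm

variable {Ω' : Type v} [mΩ' : MeasurableSpace Ω'] {P' : Measure Ω'} {π : Ω' → Ω} {Z : Ω' → ℝ}

/-- The variable `√L Z` on the extension satisfies exactly the relation that the Wiener integrals of
the kernels satisfy asymptotically. -/
lemma IsIndepNormalOnExtension.setIntegral_exp (hBm : ∀ t, Measurable (B t))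
    (h : IsIndepNormalOnExtension P B P' π Z) {L : ℝ} (hL : 0 < L) (r : ℝ) {A : Set Ω}
    (hA : MeasurableSet[brownianSigma P B] A) :
    ∫ ω' in π ⁻¹' A, Complex.exp (Complex.I * (r * (Real.sqrt L * Z ω') : ℝ)) ∂P' =
      P.real A * Complex.exp ((-(r ^ 2 * L) / 2 : ℝ)) := by
  have hZ : HasGaussianLaw Z P' := h.law.hasGaussianLaw
  have := hZ.isProbabilityMeasure
  obtain ⟨A', hA', hAA'⟩ := hA
  have hpath : Measurable (fun ω (t : ℝ≥0) => B t ω) := measurable_pi_lambda _ hBm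
  have hle : MeasurableSpace.comap (fun ω' (t : ℝ≥0) => B t (π ω')) MeasurableSpace.pi ≤ mΩ' :=
    Measurable.comap_le (hpath.comp h.extension.measurable)
  rw [← comap_pi_eq_iSup] at hA'
  have hA'm : MeasurableSet A' := hpath.comap_le _ hA'
  have hpre : MeasurableSet[MeasurableSpace.comap (fun ω' (t : ℝ≥0) => B t (π ω'))
      MeasurableSpace.pi] (π ⁻¹' A') := by
    obtain ⟨S, hS, rfl⟩ := hA'
    exact ⟨S, hS, rfl⟩
  rw [setIntegral_congr_set (h.extension.quasiMeasurePreserving.preimage_ae_eq hAA'),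
    measureReal_congr hAA']
  have hind := ((IndepFun_iff_Indep _ _ _).1 h.indep).symm
  rw [hind.setIntegral_eq_smul hle (f := fun x : ℝ =>
      Complex.exp (Complex.I * (r * (Real.sqrt L * x) : ℝ))) h.law.aemeasurable hpre (by fun_prop),
    Complex.real_smul]
  congr 1
  · rw [measureReal_def, measureReal_def,
      h.extension.measure_preimage hA'm.nullMeasurableSet]
  · have h0 : ∫ ω', Z ω' ∂P' = 0 := by rw [h.law.integral_eq, integral_id_gaussianReal]
    have h2 : ∫ ω', Z ω' ^ 2 ∂P' = 1 := by
      rw [← variance_of_integral_eq_zero h.law.aemeasurable h0, h.law.variance_eq,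
        variance_id_gaussianReal]
      rfl
    have := integral_exp_of_hasGaussianLaw hZ h0 (r * Real.sqrt L)
    rw [h2, mul_one, mul_pow, Real.sq_sqrt hL.le] at this
    rw [← this]
    simp_rw [mul_assoc]

end Extension

/-! ### Mixing of the Wiener integrals of the kernels -/

section KernelMixing

variable {Ω : Type u} [mΩ : MeasurableSpace Ω] {P : Measure Ω} {B : ℝ≥0 → Ω → ℝ}

lemma isItoIntegral_itoIntegral {𝓕 : Filtration I mΩ} {X : I → Ω → ℝ}
    (h : ∃ Y, IsItoIntegral P 𝓕 B X Y) : IsItoIntegral P 𝓕 B X (itoIntegral P 𝓕 B X) := by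
  unfold itoIntegral
  rw [dif_pos h]
  exact h.choose_spec

variable [P.IsComplete]

lemma brownianSigma_le (hBm : ∀ t, Measurable (B t)) : brownianSigma P B ≤ mΩ := by
  rintro A ⟨A', hA', h⟩
  have hle : (⨆ s : ℝ≥0, MeasurableSpace.comap (B s) inferInstance) ≤ mΩ :=
    iSup_le fun r => (hBm r).comap_le
  exact NullMeasurableSet.measurable_of_complete ⟨A', hle _ hA', h⟩

lemma brownianFiltration_le_brownianSigma (hBm : ∀ t, Measurable (B t)) (t : I) :
    brownianFiltration P B hBm t ≤ brownianSigma P B := by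
  rintro A ⟨A', hA', h⟩
  have hle : (⨆ s : Set.Iic (unitInterval.toNNReal t), MeasurableSpace.comap (B s) inferInstance) ≤
      ⨆ s : ℝ≥0, MeasurableSpace.comap (B s) inferInstance :=
    iSup_le fun r => le_iSup (fun s : ℝ≥0 => MeasurableSpace.comap (B s) inferInstance) r.1
  exact ⟨A', hle _ hA', h⟩

variable [IsProbabilityMeasure P] {hBm : ∀ t, Measurable (B t)}
  {φ : ℕ → I → ℝ} {L : ℝ} {u : I → Ω → ℝ}

lemma exists_isItoIntegral_kernel_mul (hB : IsPreBrownianReal B P)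
    (hu : IsProgressive (brownianFiltration P B hBm) u)
    (hu2 : ∫⁻ t : I, ∫⁻ ω, ‖u t ω‖ₑ ^ 2 ∂P < ∞) {ψ : I → ℝ} (hψ : Measurable ψ) {C : ℝ}
    (hC : ∀ t, |ψ t| ≤ C) :
    ∃ Y, IsItoIntegral P (brownianFiltration P B hBm) B (fun t ω => ψ t * u t ω) Y := by
  refine exists_isItoIntegral hB ((isProgressive_deterministic _ hψ).mul hu) ?_
  calc ∫⁻ t : I, ∫⁻ ω, ‖ψ t * u t ω‖ₑ ^ 2 ∂P
      ≤ ∫⁻ t : I, ∫⁻ ω, ENNReal.ofReal C ^ 2 * ‖u t ω‖ₑ ^ 2 ∂P := by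
        refine lintegral_mono fun t => lintegral_mono fun ω => ?_
        simp only
        rw [enorm_mul, mul_pow]
        gcongr
        rw [← ofReal_norm]
        exact ENNReal.ofReal_le_ofReal (hC t)
    _ = ENNReal.ofReal C ^ 2 * ∫⁻ t : I, ∫⁻ ω, ‖u t ω‖ₑ ^ 2 ∂P := by
        have hfin : ENNReal.ofReal C ^ 2 ≠ ∞ := ENNReal.pow_ne_top ENNReal.ofReal_ne_top
        simp_rw [lintegral_const_mul' _ _ hfin]
    _ < ∞ := ENNReal.mul_lt_top (ENNReal.pow_lt_top ENNReal.ofReal_lt_top) hu2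

/-- The Wiener integrals of the kernels over `(δ, 1]` are asymptotically independent of `B` and
asymptotically normal with variance `L` (mixing convergence). -/
lemma exists_wienerIntegral_mixing (hB : IsBrownianReal B P)
    (hφm : ∀ n, Measurable (φ n)) (hφ0 : ∀ n t, 0 ≤ φ n t)
    (hφb : ∀ n, ∃ C : ℝ, ∀ t, φ n t ≤ C)
    (h1 : Tendsto (fun n => ∫ t, φ n t ^ 2) atTop (𝓝 L))
    (h2 : ∀ δ : I, δ < 1 → Tendsto (fun n => ⨆ t : Set.Icc 0 δ, φ n t) atTop (𝓝 0))
    {δ : I} (hδ : δ < 1) :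
    ∃ G : ℕ → Ω → ℝ, (∀ n, MemLp (G n) 2 P) ∧
      (∀ n (v : Ω → ℝ), Measurable[brownianFiltration P B hBm δ] v →
        (∃ D : ℝ, ∀ ω, |v ω| ≤ D) → IsItoIntegral P (brownianFiltration P B hBm) B
          (fun t ω => (Set.Ioi δ).indicator (φ n) t * v ω) (fun ω => v ω * G n ω)) ∧
      ∀ r : ℝ, ∀ A, MeasurableSet[brownianSigma P B] A →
        Tendsto (fun n => ∫ ω in A, Complex.exp (Complex.I * (r * G n ω : ℝ)) ∂P) atTop
          (𝓝 (P.real A * Complex.exp ((-(r ^ 2 * L) / 2 : ℝ)))) := by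
  have hB' := hB.toIsPreBrownianReal
  choose C hC using exists_abs_le hφ0 hφb
  choose G hG hGv V hVδ hVdet hVφ hVG using fun (n : ℕ) (δ : I) =>
    exists_wienerIntegral (hBm := hBm) hB' (hφm n) (hC n) δ
  have hone (n : ℕ) (δ : I) : IsItoIntegral P (brownianFiltration P B hBm) B
      (fun t _ => (Set.Ioi δ).indicator (φ n) t) (G n δ) := by
    have := hGv n δ (fun _ => 1) measurable_const ⟨1, fun _ => by simp⟩
    simpa only [mul_one, one_mul] using this
  have hm (n : ℕ) (δ : I) :
      Measurable (fun p : I × Ω => (Set.Ioi δ).indicator (φ n) p.1) :=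
    ((hφm n).indicator measurableSet_Ioi).comp measurable_fst
  refine ⟨fun n => G n δ, fun n => hG n δ, fun n v hv hvb => hGv n δ v hv hvb, fun r A hA => ?_⟩
  obtain ⟨d, hd, hdI, hd1⟩ := exists_seq_strictMono_tendsto' hδ
  refine tendsto_setIntegral_brownianSigma hBm hB (d := fun k => unitInterval.toNNReal (d k))
    (fun k l hkl => hd.monotone hkl) ?_
    (fun n => aestronglyMeasurable_exp_I_mul (hG n δ).1.aemeasurable r)
    (fun n ω => (Complex.norm_exp_I_mul_ofReal _).le) (fun k A hA => ?_) hA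
  · have := (unitInterval.toNNReal_continuous.tendsto 1).comp hd1
    rwa [unitInterval.toNNReal_one] at this
  have hAm : MeasurableSet A := outsideSigma_le hBm _ _ hA
  -- the Wiener integral over `(d k, 1]` is independent of `A`
  have hlim : Tendsto (fun n => ∫ ω in A, Complex.exp (Complex.I * (r * G n (d k) ω : ℝ)) ∂P) atTop
      (𝓝 (P.real A * Complex.exp ((-(r ^ 2 * L) / 2 : ℝ)))) := by
    have hs := tendsto_integral_indicator_sq hφm hφ0 hφb h1 (h2 _ (hdI k).2)
    have hcont : Continuous (fun x : ℝ => (P.real A : ℂ) *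
        Complex.exp ((-(r ^ 2 * x) / 2 : ℝ))) := by fun_prop
    refine ((hcont.tendsto L).comp hs).congr fun n => ?_
    refine (setIntegral_exp_wienerIntegral hB' ((hφm n).indicator measurableSet_Ioi)
      (C := C n) (fun t => ?_) (hG n (d k)) (hVδ n (d k)) (hVdet n (d k)) (hVφ n (d k))
      (hVG n (d k)) hA hAm r).symm
    exact (norm_indicator_le_norm_self (φ n) t).trans (hC n t)
  -- and it is asymptotically equal to the one over `(δ, 1]`
  have hdist := tendsto_processDist_indicator (P := P) hφ0 hφb (hdI k).1.le (h2 _ (hdI k).2)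
  have hdiff : Tendsto (fun n => |r| * (processDist P (fun t _ => (Set.Ioi δ).indicator (φ n) t)
      (fun t _ => (Set.Ioi (d k)).indicator (φ n) t)).toReal) atTop (𝓝 0) := by
    have := ((ENNReal.tendsto_toReal ENNReal.zero_ne_top).comp hdist).const_mul |r|
    rwa [ENNReal.toReal_zero, mul_zero] at this
  have hfin : ∀ᶠ n in atTop, processDist P (fun t _ => (Set.Ioi δ).indicator (φ n) t)
      (fun t _ => (Set.Ioi (d k)).indicator (φ n) t) < 1 :=
    hdist.eventually (gt_mem_nhds one_pos)
  refine tendsto_of_forall_approx fun ε hε => ⟨_, _, hlim, ?_, by simpa using hε.le⟩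
  filter_upwards [hdiff.eventually (gt_mem_nhds hε), hfin] with n hn hnfin
  have hI (δ : I) : Integrable (fun ω => Complex.exp (Complex.I * (r * G n δ ω : ℝ))) P :=
    Integrable.of_bound (aestronglyMeasurable_exp_I_mul (hG n δ).1.aemeasurable r) 1
      (ae_of_all _ fun ω => (Complex.norm_exp_I_mul_ofReal _).le)
  have hsub := (hG n δ).sub (hG n (d k))
  rw [← integral_sub (hI δ).integrableOn (hI (d k)).integrableOn]
  calc _ ≤ ∫ ω in A, |r| * |G n δ ω - G n (d k) ω| ∂P := by
        refine norm_integral_le_of_norm_le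
          (((hsub.integrable (by norm_num)).abs.const_mul |r|).integrableOn)
          (ae_of_all _ fun ω => ?_)
        rw [← abs_mul, mul_sub]
        exact norm_exp_I_mul_sub_le _ _
    _ ≤ ∫ ω, |r| * |G n δ ω - G n (d k) ω| ∂P :=
        setIntegral_le_integral ((hsub.integrable (by norm_num)).abs.const_mul |r|)
          (ae_of_all _ fun ω => by positivity)
    _ = |r| * ∫ ω, |G n δ ω - G n (d k) ω| ∂P := integral_const_mul _ _
    _ ≤ |r| * (processDist P (fun t _ => (Set.Ioi δ).indicator (φ n) t)
          (fun t _ => (Set.Ioi (d k)).indicator (φ n) t)).toReal := by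
        gcongr
        refine (integral_abs_le_eLpNorm_two hsub).trans
          (ENNReal.toReal_mono (hnfin.trans ENNReal.one_lt_top).ne ?_)
        exact (hone n δ).eLpNorm_sub_le hB' (hm n δ) (hm n (d k)) (hone n (d k))
    _ ≤ ε := hn.le

end KernelMixing

/-! ### Stable convergence of the Itô integrals -/

section StableLimit

lemma exists_finite_range_eLpNorm_sub_lt {α : Type*} {m : MeasurableSpace α} {μ : Measure α}
    {f : α → ℝ} (hf : MemLp f 2 μ) {ε : ℝ≥0∞} (hε : ε ≠ 0) :
    ∃ g : α → ℝ, Measurable g ∧ (Set.range g).Finite ∧ eLpNorm (f - g) 2 μ < ε := by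
  obtain ⟨g, hg, -⟩ := hf.exists_simpleFunc_eLpNorm_sub_lt (by norm_num) hε
  exact ⟨g, g.measurable, g.finite_range, hg⟩

variable {Ω : Type u} [mΩ : MeasurableSpace Ω] {P : Measure Ω} {u : I → Ω → ℝ}

/-- Continuity in `L²` at `1` forces the terminal variable `u 1` to be square integrable, although
a single time is negligible for `dt`. -/
lemma memLp_terminal [IsProbabilityMeasure P] (hum : Measurable (fun p : I × Ω => u p.1 p.2))
    (hu2 : ∫⁻ t : I, ∫⁻ ω, ‖u t ω‖ₑ ^ 2 ∂P < ∞)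
    (hu1 : Tendsto (fun t : I => eLpNorm (fun ω => u t ω - u 1 ω) 2 P) (𝓝 1) (𝓝 0)) :
    MemLp (u 1) 2 P := by
  have hm (t : I) : Measurable (u t) := hum.comp measurable_prodMk_left
  have h1 : ∀ᵐ t : I, ∫⁻ ω, ‖u t ω‖ₑ ^ 2 ∂P < ∞ :=
    ae_lt_top ((hum.enorm.pow_const 2).lintegral_prod_right') hu2.ne
  obtain ⟨l, hl, hl'⟩ := exists_Ioc_subset_of_mem_nhds (hu1.eventually (gt_mem_nhds one_pos))
    ⟨0, zero_lt_one⟩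
  -- almost every, hence some time close to `1` is good
  obtain ⟨t, ht, htl⟩ : ∃ t : I, (∫⁻ ω, ‖u t ω‖ₑ ^ 2 ∂P < ∞) ∧ t ∈ Set.Ioc l 1 := by
    by_contra! hcon
    have : volume (Set.Ioc l 1) = 0 :=
      measure_mono_null (fun t ht => fun h => hcon t h ht) h1
    rw [unitInterval.volume_Ioc, ENNReal.ofReal_eq_zero] at this
    have hl1 : (l : ℝ) < 1 := hl
    simp only [Set.Icc.coe_one] at this
    linarith
  have hut : MemLp (u t) 2 P := by
    refine ⟨(hm t).aestronglyMeasurable, ?_⟩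
    rw [← eLpNorm_two_sq] at ht
    exact lt_of_not_ge fun h => by simp [top_le_iff.1 h] at ht
  have hdiff : MemLp (fun ω => u t ω - u 1 ω) 2 P :=
    ⟨((hm t).sub (hm 1)).aestronglyMeasurable, lt_trans (hl' htl) ENNReal.one_lt_top⟩
  convert hut.sub hdiff using 1
  ext ω
  simp

variable {φ : ℕ → I → ℝ} {L : ℝ}

/-- Replacing `u` by `v` on `(δ, 1]` and dropping the integrand on `[0, δ]` costs asymptotically at
most `ε √L` in `L²(dt ⊗ P)`; with `L + 1` in place of `L`, the bound holds eventually. -/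
lemma eventually_processDist_le [IsProbabilityMeasure P]
    (hum : Measurable (fun p : I × Ω => u p.1 p.2))
    (hu2 : ∫⁻ t : I, ∫⁻ ω, ‖u t ω‖ₑ ^ 2 ∂P < ∞)
    (hφm : ∀ n, Measurable (φ n)) (hφ0 : ∀ n t, 0 ≤ φ n t)
    (hφb : ∀ n, ∃ C : ℝ, ∀ t, φ n t ≤ C) (hL : 0 < L)
    (h1 : Tendsto (fun n => ∫ t, φ n t ^ 2) atTop (𝓝 L)) {δ : I}
    (h2 : Tendsto (fun n => ⨆ t : Set.Icc 0 δ, φ n t) atTop (𝓝 0))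
    {v : Ω → ℝ} (hv : Measurable v) {ε : ℝ} (hε : 0 < ε)
    (hvu : ∀ t, δ ≤ t → eLpNorm (fun ω => u t ω - v ω) 2 P ≤ ENNReal.ofReal ε) :
    ∀ᶠ n in atTop, processDist P (fun t ω => φ n t * u t ω)
      (fun t ω => (Set.Ioi δ).indicator (φ n) t * v ω) ≤
        ENNReal.ofReal (ε * Real.sqrt (L + 1)) := by
  have hi (n : ℕ) : Integrable (fun t => φ n t ^ 2) := by
    obtain ⟨C, hC⟩ := exists_abs_le hφ0 hφb n
    refine Integrable.of_bound ((hφm n).pow_const 2).aestronglyMeasurable (C ^ 2)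
      (ae_of_all _ fun t => ?_)
    rw [norm_pow]
    exact pow_le_pow_left₀ (norm_nonneg _) (hC t) 2
  let U : ℝ≥0∞ := ∫⁻ t : I, ∫⁻ ω, ‖u t ω‖ₑ ^ 2 ∂P
  let s (n : ℕ) : ℝ := ⨆ t : Set.Icc 0 δ, φ n t
  have hXm (n : ℕ) : Measurable (fun p : I × Ω => φ n p.1 * u p.1 p.2) :=
    ((hφm n).comp measurable_fst).mul hum
  have hYm (n : ℕ) : Measurable (fun p : I × Ω => (Set.Ioi δ).indicator (φ n) p.1 * v p.2) :=
    (((hφm n).indicator measurableSet_Ioi).comp measurable_fst).mul (hv.comp measurable_snd)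
  have hbound (n : ℕ) : processDist P (fun t ω => φ n t * u t ω)
      (fun t ω => (Set.Ioi δ).indicator (φ n) t * v ω) ^ 2 ≤
      ENNReal.ofReal (s n) ^ 2 * U +
        ENNReal.ofReal (∫ t, φ n t ^ 2) * ENNReal.ofReal ε ^ 2 := by
    have hpt (t : I) : ∫⁻ ω, ‖φ n t * u t ω - (Set.Ioi δ).indicator (φ n) t * v ω‖ₑ ^ 2 ∂P ≤
        ENNReal.ofReal (s n) ^ 2 * ∫⁻ ω, ‖u t ω‖ₑ ^ 2 ∂P +
          ENNReal.ofReal (φ n t ^ 2) * ENNReal.ofReal ε ^ 2 := by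
      have hfin : ‖φ n t‖ₑ ^ 2 ≠ ∞ := ENNReal.pow_ne_top enorm_ne_top
      by_cases ht : δ < t
      · refine le_trans ?_ le_add_self
        have e (ω : Ω) : ‖φ n t * u t ω - (Set.Ioi δ).indicator (φ n) t * v ω‖ₑ ^ 2 =
            ‖φ n t‖ₑ ^ 2 * ‖u t ω - v ω‖ₑ ^ 2 := by
          rw [Set.indicator_of_mem (show t ∈ Set.Ioi δ from ht), ← mul_sub, enorm_mul, mul_pow]
        simp_rw [e]
        rw [lintegral_const_mul' _ _ hfin, ← eLpNorm_two_sq, ENNReal.ofReal_pow (hφ0 n t)]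
        rw [Real.enorm_of_nonneg (hφ0 n t)]
        gcongr
        exact hvu t ht.le
      · refine le_trans ?_ le_self_add
        have e (ω : Ω) : ‖φ n t * u t ω - (Set.Ioi δ).indicator (φ n) t * v ω‖ₑ ^ 2 =
            ‖φ n t‖ₑ ^ 2 * ‖u t ω‖ₑ ^ 2 := by
          rw [Set.indicator_of_notMem (show t ∉ Set.Ioi δ from ht), zero_mul, sub_zero, enorm_mul,
            mul_pow]
        simp_rw [e]
        rw [lintegral_const_mul' _ _ hfin, Real.enorm_of_nonneg (hφ0 n t)]
        gcongr
        exact le_iSup_kernel hφb n (not_lt.1 ht)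
    rw [processDist_sq (hXm n) (hYm n)]
    refine (lintegral_mono hpt).trans (le_of_eq ?_)
    rw [lintegral_add_right _ ((((hφm n).pow_const 2).ennreal_ofReal).mul_const _),
      lintegral_const_mul' _ _ (ENNReal.pow_ne_top ENNReal.ofReal_ne_top),
      lintegral_mul_const' _ _ (ENNReal.pow_ne_top ENNReal.ofReal_ne_top),
      ← ofReal_integral_eq_lintegral_ofReal (hi n) (ae_of_all _ fun t => sq_nonneg _)]
  have hlim : Tendsto (fun n => ENNReal.ofReal (s n) ^ 2 * U +
      ENNReal.ofReal (∫ t, φ n t ^ 2) * ENNReal.ofReal ε ^ 2) atTop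
      (𝓝 (ENNReal.ofReal 0 ^ 2 * U + ENNReal.ofReal L * ENNReal.ofReal ε ^ 2)) := by
    refine Tendsto.add (ENNReal.Tendsto.mul_const (ENNReal.Tendsto.pow (ENNReal.tendsto_ofReal h2))
      (Or.inr hu2.ne)) (ENNReal.Tendsto.mul_const (ENNReal.tendsto_ofReal h1)
        (Or.inr (ENNReal.pow_ne_top ENNReal.ofReal_ne_top)))
  rw [ENNReal.ofReal_zero, zero_pow two_ne_zero, zero_mul, zero_add] at hlim
  have hlt : ENNReal.ofReal L * ENNReal.ofReal ε ^ 2 <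
      ENNReal.ofReal (ε * Real.sqrt (L + 1)) ^ 2 := by
    rw [← ENNReal.ofReal_pow hε.le, ← ENNReal.ofReal_mul hL.le,
      ← ENNReal.ofReal_pow (by positivity), mul_pow, Real.sq_sqrt (by positivity),
      ENNReal.ofReal_lt_ofReal_iff (by positivity)]
    nlinarith [pow_pos hε 2]
  filter_upwards [hlim.eventually (gt_mem_nhds hlt)] with n hn
  exact (ENNReal.pow_right_strictMono two_ne_zero).le_iff_le.1 ((hbound n).trans hn.le)

variable {Ω' : Type v} [mΩ' : MeasurableSpace Ω'] {P' : Measure Ω'} {π : Ω' → Ω} {Z : Ω' → ℝ}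

/-- The limit functional depends continuously on the random standard deviation. -/
lemma norm_integral_mul_exp_extension_sub_le [IsProbabilityMeasure P']
    (hπ : MeasurePreserving π P' P) (hZ : MemLp Z 2 P') {Y : Ω → ℝ} (hY : Measurable Y) {C : ℝ}
    (hC0 : 0 ≤ C) (hC : ∀ ω, |Y ω| ≤ C) {w v : Ω → ℝ} (hw : Measurable w) (hv : Measurable v)
    (a r : ℝ) {ε : ℝ} (hε : 0 ≤ ε) (hwv : eLpNorm (fun ω => w ω - v ω) 2 P ≤ ENNReal.ofReal ε) :
    ‖∫ ω', (Y (π ω') : ℂ) * Complex.exp (Complex.I * (r * (v (π ω') * (a * Z ω')) : ℝ)) ∂P' -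
      ∫ ω', (Y (π ω') : ℂ) * Complex.exp (Complex.I * (r * (a * w (π ω') * Z ω') : ℝ)) ∂P'‖ ≤
      C * |r| * (|a| * (ε * (eLpNorm Z 2 P').toReal)) := by
  have hwv' : MemLp (fun ω => w ω - v ω) 2 P :=
    ⟨(hw.sub hv).aestronglyMeasurable, hwv.trans_lt ENNReal.ofReal_lt_top⟩
  have hcomp : MemLp (fun ω' => w (π ω') - v (π ω')) 2 P' := hwv'.comp_measurePreserving hπ
  have hprod : Integrable (fun ω' => (w (π ω') - v (π ω')) * Z ω') P' := hcomp.integrable_mul hZ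
  have e (ω' : Ω') : v (π ω') * (a * Z ω') - a * w (π ω') * Z ω' =
      -a * ((w (π ω') - v (π ω')) * Z ω') := by ring
  have hint : Integrable (fun ω' => v (π ω') * (a * Z ω') - a * w (π ω') * Z ω') P' := by
    refine (hprod.const_mul (-a)).congr (ae_of_all _ fun ω' => ?_)
    exact (e ω').symm
  have hπm := hπ.measurable
  have hbound : _ ≤ C * |r| * ∫ ω', |v (π ω') * (a * Z ω') - a * w (π ω') * Z ω'| ∂P' :=
    norm_integral_mul_exp_sub_le (P := P') (Y := fun ω' => Y (π ω'))
      (F := fun ω' => v (π ω') * (a * Z ω')) (G := fun ω' => a * w (π ω') * Z ω')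
      (hY.comp hπm).aemeasurable (fun ω' => hC _)
      ((hv.comp hπm).aemeasurable.mul (hZ.1.aemeasurable.const_mul a))
      (((hw.comp hπm).aemeasurable.const_mul a).mul hZ.1.aemeasurable) hint r
  refine hbound.trans (mul_le_mul_of_nonneg_left ?_ (by positivity))
  have hscale : ∫ ω', |v (π ω') * (a * Z ω') - a * w (π ω') * Z ω'| ∂P' =
      |a| * ∫ ω', |(w (π ω') - v (π ω')) * Z ω'| ∂P' := by
    rw [← integral_const_mul]
    refine integral_congr_ae (ae_of_all _ fun ω' => ?_)
    beta_reduce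
    rw [e, abs_mul (-a), abs_neg]
  rw [hscale]
  refine mul_le_mul_of_nonneg_left ?_ (abs_nonneg a)
  have hnorm : ∫ ω', |(w (π ω') - v (π ω')) * Z ω'| ∂P' =
      (eLpNorm (fun ω' => (w (π ω') - v (π ω')) * Z ω') 1 P').toReal := by
    rw [eLpNorm_one_eq_lintegral_enorm, ← integral_norm_eq_lintegral_enorm hprod.1]
    rfl
  rw [hnorm, ← ENNReal.toReal_ofReal hε, ← ENNReal.toReal_mul]
  refine ENNReal.toReal_mono (ENNReal.mul_ne_top ENNReal.ofReal_ne_top hZ.2.ne) ?_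
  refine (eLpNorm_smul_le_mul_eLpNorm (p := 2) (q := 2) (r := 1) hZ.1 hcomp.1).trans ?_
  gcongr
  exact (eLpNorm_comp_measurePreserving (g := fun ω => w ω - v ω)
    (hw.sub hv).aestronglyMeasurable hπ).le.trans hwv

variable [P.IsComplete] {B : ℝ≥0 → Ω → ℝ} {hBm : ∀ t, Measurable (B t)}

/-- Close to time `1`, the process `u` is close in `L²` to a bounded variable `v` with finitely
many values which is known strictly before time `1`. -/
lemma exists_finite_range_approx [IsProbabilityMeasure P]
    (hu : IsProgressive (brownianFiltration P B hBm) u)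
    (hu2 : ∫⁻ t : I, ∫⁻ ω, ‖u t ω‖ₑ ^ 2 ∂P < ∞)
    (hu1 : Tendsto (fun t : I => eLpNorm (fun ω => u t ω - u 1 ω) 2 P) (𝓝 1) (𝓝 0))
    {ε : ℝ≥0∞} (hε : ε ≠ 0) :
    ∃ δ : I, δ < 1 ∧ ∃ v : Ω → ℝ, Measurable[brownianFiltration P B hBm δ] v ∧
      (Set.range v).Finite ∧ ∀ t, δ ≤ t → eLpNorm (fun ω => u t ω - v ω) 2 P ≤ ε := by
  have hε3 : 0 < ε / 3 := ENNReal.div_pos hε (by norm_num)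
  have hum := hu.measurable_uncurry
  have hm (t : I) : Measurable (u t) := hum.comp measurable_prodMk_left
  obtain ⟨l, hl, hl'⟩ := exists_Ioc_subset_of_mem_nhds (hu1.eventually (ge_mem_nhds hε3))
    ⟨0, zero_lt_one⟩
  obtain ⟨l₂, hl₂, hl₂'⟩ := exists_Ioc_subset_of_mem_nhds (hu1.eventually (gt_mem_nhds one_pos))
    ⟨0, zero_lt_one⟩
  obtain ⟨δ, hδ, hδ1⟩ := exists_between (max_lt hl hl₂)
  have hlδ : l < δ := (le_max_left _ _).trans_lt hδ
  have hclose (t : I) (ht : δ ≤ t) : eLpNorm (fun ω => u t ω - u 1 ω) 2 P ≤ ε / 3 :=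
    hl' ⟨hlδ.trans_le ht, unitInterval.le_one'⟩
  have hu1' := memLp_terminal hum hu2 hu1
  have hdiff : MemLp (fun ω => u δ ω - u 1 ω) 2 P :=
    ⟨((hm δ).sub (hm 1)).aestronglyMeasurable,
      lt_trans (hl₂' ⟨(le_max_right _ _).trans_lt hδ, hδ1.le⟩) ENNReal.one_lt_top⟩
  have huδ : MemLp (u δ) 2 P := by
    convert hdiff.add hu1' using 1
    ext ω
    simp
  have hF := (brownianFiltration P B hBm).le δ
  have huδm : Measurable[brownianFiltration P B hBm δ] (u δ) := hu.adapted δ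
  have huδt : @MemLp Ω ℝ (brownianFiltration P B hBm δ) _ _ (u δ) 2 (P.trim hF) := by
    refine ⟨huδm.aestronglyMeasurable, ?_⟩
    rw [eLpNorm_trim hF huδm.stronglyMeasurable]
    exact huδ.2
  obtain ⟨g, hgm, hgfin, hg⟩ := exists_finite_range_eLpNorm_sub_lt huδt hε3.ne'
  rw [eLpNorm_trim hF (huδm.sub hgm).stronglyMeasurable] at hg
  refine ⟨δ, hδ1, g, hgm, hgfin, fun t ht => ?_⟩
  have hgm₀ : Measurable g := hgm.mono hF le_rfl
  have e : (fun ω => u t ω - g ω) = (fun ω => u t ω - u 1 ω) +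
      (fun ω => -(u δ ω - u 1 ω)) + (u δ - g) := by
    ext ω; simp
  have hneg : eLpNorm (fun ω => -(u δ ω - u 1 ω)) 2 P = eLpNorm (fun ω => u δ ω - u 1 ω) 2 P :=
    eLpNorm_neg _ _ _
  rw [e]
  calc _ ≤ eLpNorm (fun ω => u t ω - u 1 ω) 2 P + eLpNorm (fun ω => -(u δ ω - u 1 ω)) 2 P +
        eLpNorm (u δ - g) 2 P := by
        refine (eLpNorm_add_le ?_ ?_ (by norm_num)).trans
          (add_le_add_left (eLpNorm_add_le ?_ ?_ (by norm_num)) _)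
        · exact (((hm t).sub (hm 1)).add ((hm δ).sub (hm 1)).neg).aestronglyMeasurable
        · exact ((hm δ).sub hgm₀).aestronglyMeasurable
        · exact ((hm t).sub (hm 1)).aestronglyMeasurable
        · exact ((hm δ).sub (hm 1)).neg.aestronglyMeasurable
    _ ≤ ε / 3 + ε / 3 + ε / 3 := by
        rw [hneg]
        exact add_le_add (add_le_add (hclose t ht) (hclose δ le_rfl)) hg.le
    _ = ε := ENNReal.add_thirds ε

/-- Stable convergence of any versions `F n` of the Itô integrals of `φ n * u`. -/
theorem convergesStably_of_isItoIntegral [IsProbabilityMeasure P] (hB : IsBrownianReal B P)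
    (hu : IsProgressive (brownianFiltration P B hBm) u)
    (hu2 : ∫⁻ t : I, ∫⁻ ω, ‖u t ω‖ₑ ^ 2 ∂P < ∞)
    (hu1 : Tendsto (fun t : I => eLpNorm (fun ω => u t ω - u 1 ω) 2 P) (𝓝 1) (𝓝 0))
    (hφm : ∀ n, Measurable (φ n)) (hφ0 : ∀ n t, 0 ≤ φ n t)
    (hφb : ∀ n, ∃ C : ℝ, ∀ t, φ n t ≤ C) (hL : 0 < L)
    (h1 : Tendsto (fun n => ∫ t, φ n t ^ 2) atTop (𝓝 L))
    (h2 : ∀ δ : I, δ < 1 → Tendsto (fun n => ⨆ t : Set.Icc 0 δ, φ n t) atTop (𝓝 0))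
    {F : ℕ → Ω → ℝ} (hF : ∀ n, IsItoIntegral P (brownianFiltration P B hBm) B
      (fun t ω => φ n t * u t ω) (F n))
    (hZ : IsIndepNormalOnExtension P B P' π Z) :
    ConvergesStably P (brownianSigma P B) F P' π (fun ω' => Real.sqrt L * u 1 (π ω') * Z ω') := by
  have hZG : HasGaussianLaw Z P' := hZ.law.hasGaussianLaw
  have hP' : IsProbabilityMeasure P' := hZG.isProbabilityMeasure
  have hum := hu.measurable_uncurry
  have hum1 : Measurable (u 1) := hum.comp measurable_prodMk_left
  refine ⟨fun n => (hF n).1.1.aemeasurable,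
    ((hum1.comp hZ.extension.measurable).aemeasurable.const_mul _).mul hZ.law.aemeasurable,
    fun r Y hY hYb => ?_⟩
  obtain ⟨C₀, hC₀⟩ := hYb
  obtain ⟨C, hC0, hC⟩ : ∃ C : ℝ, 0 ≤ C ∧ ∀ ω, |Y ω| ≤ C :=
    ⟨max C₀ 0, le_max_right _ _, fun ω => (hC₀ ω).trans (le_max_left _ _)⟩
  have hle : brownianSigma P B ≤ mΩ := brownianSigma_le hBm
  have hYm : Measurable Y := hY.mono hle le_rfl
  set K : ℝ := (eLpNorm Z 2 P').toReal with hK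
  refine tendsto_of_forall_approx fun η hη => ?_
  -- `M` collects the constants in the two errors `E|F n - v * G n|` and `E'|√L (u 1 - v) Z|`, and
  -- `ε` is the accuracy of the approximation of `u` that they require
  set M : ℝ := C * |r| * (Real.sqrt (L + 1) + |Real.sqrt L| * K) + 1 with hM
  have hK0 : 0 ≤ K := ENNReal.toReal_nonneg
  have hM0 : 0 < M := by positivity
  set ε : ℝ := η / M with hεdef
  have hε : 0 < ε := by positivity
  have hεM : ε * M = η := by rw [hεdef]; field_simp
  obtain ⟨δ, hδ, v, hv, hvfin, hvu⟩ := exists_finite_range_approx hu hu2 hu1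
    (ENNReal.ofReal_pos.2 hε).ne'
  obtain ⟨G, hG, hGv, hmix⟩ := exists_wienerIntegral_mixing (hBm := hBm) hB hφm hφ0 hφb h1 h2 hδ
  have hvm : Measurable v := hv.mono ((brownianFiltration P B hBm).le δ) le_rfl
  have hvσ : Measurable[brownianSigma P B] v :=
    hv.mono (brownianFiltration_le_brownianSigma hBm δ) le_rfl
  have hvb : ∃ D : ℝ, ∀ ω, |v ω| ≤ D := by
    obtain ⟨D, hD⟩ := hvfin.isBounded.exists_norm_le
    exact ⟨D, fun ω => hD _ ⟨ω, rfl⟩⟩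
  have hlimG := tendsto_integral_mul_exp_of_mixing hle (MeasurePreserving.id P)
    (fun n => (hG n).1.aemeasurable) hmix hY hC hvσ hvfin r
  have hlimZ := tendsto_integral_mul_exp_of_mixing hle hZ.extension
    (W := fun _ ω' => Real.sqrt L * Z ω') (fun _ => hZ.law.aemeasurable.const_mul _)
    (fun r A hA => by rw [hZ.setIntegral_exp hBm hL r hA]; exact tendsto_const_nhds)
    hY hC hvσ hvfin r
  rw [← tendsto_nhds_unique tendsto_const_nhds hlimZ] at hlimG
  refine ⟨_, _, hlimG, ?_, ?_⟩
  · filter_upwards [eventually_processDist_le hum hu2 hφm hφ0 hφb hL h1 (h2 δ hδ) hvm hε hvu]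
      with n hn
    have hvG := hGv n v hv hvb
    have hdiff : MemLp (fun ω => F n ω - v ω * G n ω) 2 P := (hF n).1.sub hvG.1
    have hdist : ∫ ω, |F n ω - v ω * G n ω| ∂P ≤ ε * Real.sqrt (L + 1) := by
      refine (integral_abs_le_eLpNorm_two hdiff).trans ?_
      refine ENNReal.toReal_le_of_le_ofReal (by positivity) (le_trans ?_ hn)
      refine (hF n).eLpNorm_sub_le hB.toIsPreBrownianReal ?_ ?_ hvG
      · exact ((hφm n).comp measurable_fst).mul hum
      · exact (((hφm n).indicator measurableSet_Ioi).comp measurable_fst).mul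
          (hvm.comp measurable_snd)
    calc _ ≤ C * |r| * ∫ ω, |F n ω - v ω * G n ω| ∂P :=
          norm_integral_mul_exp_sub_le hYm.aemeasurable hC (hF n).1.1.aemeasurable
            hvG.1.1.aemeasurable (hdiff.integrable (by norm_num)) r
      _ ≤ C * |r| * (ε * Real.sqrt (L + 1)) :=
          mul_le_mul_of_nonneg_left hdist (by positivity)
      _ ≤ ε * M := by
          have : 0 ≤ C * |r| * (|Real.sqrt L| * K) := by positivity
          rw [hM]
          nlinarith
      _ = η := hεM
  · calc _ ≤ C * |r| * (|Real.sqrt L| * (ε * K)) :=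
          norm_integral_mul_exp_extension_sub_le hZ.extension hZG.memLp_two hYm hC0 hC hum1 hvm
            (Real.sqrt L) r hε.le (hvu 1 hδ.le)
      _ ≤ ε * M := by
          have : 0 ≤ C * |r| * Real.sqrt (L + 1) := by positivity
          rw [hM]
          nlinarith
      _ = η := hεM

end StableLimit

theorem theorem1
    {Ω : Type u} [mΩ : MeasurableSpace Ω] (P : Measure Ω) [IsProbabilityMeasure P] [P.IsComplete]
    -- standard Brownian motion
    (B : ℝ≥0 → Ω → ℝ) (hBm : ∀ t, Measurable (B t)) (hB : IsBrownianReal B P)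
    -- the integrand: progressively measurable, square integrable, continuous in `L²` at `1`
    (u : I → Ω → ℝ) (hu : IsProgressive (brownianFiltration P B hBm) u)
    (hu2 : ∫⁻ t : I, ∫⁻ ω, ‖u t ω‖ₑ ^ 2 ∂P < ∞)
    (hu1 : Tendsto (fun t : I => eLpNorm (fun ω => u t ω - u 1 ω) 2 P) (𝓝 1) (𝓝 0))
    -- the kernels: bounded, nonnegative (and measurable)
    (φ : ℕ → I → ℝ) (hφm : ∀ n, Measurable (φ n)) (hφ0 : ∀ n t, 0 ≤ φ n t)
    (hφb : ∀ n, ∃ C : ℝ, ∀ t, φ n t ≤ C)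
    (L : ℝ) (hL : 0 < L)
    (h1 : ∃ α : ℕ → I, Monotone α ∧ Tendsto α atTop (𝓝 1) ∧
      Tendsto (fun n => ∫ t in Set.Icc (α n) 1, φ n t ^ 2) atTop (𝓝 L) ∧
      Tendsto (fun n => ∫ t, φ n t ^ 2) atTop (𝓝 L))
    (h2 : ∀ δ : I, δ < 1 → Tendsto (fun n => ⨆ t : Set.Icc 0 δ, φ n t) atTop (𝓝 0)) :
    -- the Itô integrals exist
    (∀ n, IsItoIntegral P (brownianFiltration P B hBm) B (fun t ω => φ n t * u t ω)
      (itoIntegral P (brownianFiltration P B hBm) B (fun t ω => φ n t * u t ω))) ∧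
    -- there is an extension that carries an independent standard normal variable
    (∃ (Ω' : Type u) (_ : MeasurableSpace Ω') (P' : Measure Ω') (π : Ω' → Ω) (Z : Ω' → ℝ),
      IsIndepNormalOnExtension P B P' π Z) ∧
    -- stable convergence, on every such extension
    (∀ (Ω' : Type v) (_ : MeasurableSpace Ω') (P' : Measure Ω') (π : Ω' → Ω) (Z : Ω' → ℝ),
      IsIndepNormalOnExtension P B P' π Z →
      ConvergesStably P (brownianSigma P B)
        (fun n => itoIntegral P (brownianFiltration P B hBm) B (fun t ω => φ n t * u t ω))
        P' π (fun ω' => Real.sqrt L * u 1 (π ω') * Z ω')) := by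
  obtain ⟨-, -, -, -, hφL⟩ := h1
  have hF (n : ℕ) : IsItoIntegral P (brownianFiltration P B hBm) B (fun t ω => φ n t * u t ω)
      (itoIntegral P (brownianFiltration P B hBm) B (fun t ω => φ n t * u t ω)) := by
    obtain ⟨C, hC⟩ := exists_abs_le hφ0 hφb n
    exact isItoIntegral_itoIntegral
      (exists_isItoIntegral_kernel_mul hB.toIsPreBrownianReal hu hu2 (hφm n) hC)
  exact ⟨hF, ⟨Ω × ℝ, inferInstance, P.prod (gaussianReal 0 1), Prod.fst, Prod.snd,
    isIndepNormalOnExtension_prod hBm⟩, fun Ω' _ P' π Z hZ =>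
    convergesStably_of_isItoIntegral hB hu hu2 hu1 hφm hφ0 hφb hL hφL h2 hF hZ⟩
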